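/- All homology is integral group homology with trivial coefficients. For a group $G$, a homomorphism $a:X\to G$ is a \emph{generalized subgroup} of $G$ if $\mathrm{Hom}(X,X)\to\mathrm{Hom}(X,G)$, $f\mapsto a\circ f$, is injective; then $K_a:=\mathrm{Ker}(a)$ is central in $X$. Two generalized subgroups $a:X\to G$ and $b:Y\to G$ are equivalent if $b h=a$ for some isomorphism $h:X\to Y$. Let $\mathrm{SurSub}(G)$ denote the collection of equivalence classes of surjective generalized subgroups of $G$. For an abelian group $A$, let $\mathrm{Quot}(A)$ denote the set of equivalence classes of surjections out of $A$, where $\sigma:A\twoheadrightarrow K$ and $\tau:A\twoheadrightarrow L$ are equivalent if $h\sigma=\tau$ for some isomorphism $h:K\to L$. For a central extension $f:X\twoheadrightarrow G$ of $G$ by $K$, the differential $\mu(f):H_2(G)\to K$ is the image of the class of $f$ under the map $H^2(G,K)\to\mathrm{Hom}(H_2(G),K)$ of the universal coefficient theorem. Let $I$ be a finite group, let $S$ be the set of primes dividing the order of $H_1(I)$, and let $H_{2\setminus 1}(I):=H_2(I)[S^{-1}]$. Then: (1) For every surjective generalized subgroup $a:X\twoheadrightarrow I$, the differential $\mu(a):H_2(I)\to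 K_a$ factors uniquely through the localization $H_2(I)\to H_{2\setminus 1}(I)$, and the resulting homomorphism $H_{2\setminus 1}(I)\to K_a$, again denoted $\mu(a)$, is surjective. (2) The assignment $[a]\mapsto[\mu(a):H_{2\setminus 1}(I)\twoheadrightarrow K_a]$ is a well-defined function $\mathrm{SurSub}(I)\to\mathrm{Quot}(H_{2\setminus 1}(I))$, and it is a bijection. (3) There is a central extension $e_I:E\twoheadrightarrow I$ of $I$ by $H_{2\setminus 1}(I)$ whose differential is the localization homomorphism $H_2(I)\to H_{2\setminus 1}(I)$, and it is unique up to equivalence of extensions (the \emph{initial extension} of $I$). (4) For every surjective generalized subgroup $a:X\twoheadrightarrow I$ there is a homomorphism $\pi:E\to X$ with $a\pi=e_I$ such that the square formed by the inclusion $H_{2\setminus 1}(I)\hookrightarrow E$, the surjection $\mu(a):H_{2\setminus 1}(I)\twoheadrightarrow K_a$, the inclusion $K_a\hookrightarrow X$ and $\pi$ is a push-out square of groups. -/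

import Mathlib

universe u

/-- Integral homology `H_n(G) = H_n(G; ℤ)` of a group, for the trivial action on `ℤ`. Mathlib's
group homology wants the coefficients in the universe of `G`, hence the `ULift`. -/
noncomputable abbrev IntHomology (G : Type u) [Group G] (n : ℕ) : Type u :=
  groupHomology (Rep.trivial (ULift.{u} ℤ) G (ULift.{u} ℤ)) n

/-- The multiplicative set of integers generated by the primes dividing the order of `H₁(G)`. -/
def h1PrimeSubmonoid (G : Type u) [Group G] : Submonoid ℤ :=
  Submonoid.closure {n : ℤ | ∃ p : ℕ, p.Prime ∧ p ∣ Nat.card (IntHomology G 1) ∧ n = (p : ℤ)}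

/-- `H_{2∖1}(G) = H₂(G)[S⁻¹]`, with `S` the set of primes dividing the order of `H₁(G)`. -/
abbrev H2Minus1 (G : Type u) [Group G] : Type u :=
  LocalizedModule (h1PrimeSubmonoid G) (IntHomology G 2)

/-- The localization homomorphism `H₂(G) → H_{2∖1}(G)`. -/
noncomputable def H2Minus1.loc (G : Type u) [Group G] : IntHomology G 2 →+ H2Minus1 G :=
  (LocalizedModule.mkLinearMap (h1PrimeSubmonoid G) (IntHomology G 2)).toAddMonoidHom

section CentralExtension

variable {K X G : Type u} [CommGroup K] [Group X] [Group G]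

/-- The extension `1 → K → X → G → 1` is central. -/
def GroupExtension.IsCentral (S : GroupExtension K X G) : Prop :=
  S.inl.range ≤ Subgroup.center X

namespace GroupExtension

variable (S : GroupExtension K X G)

/-- A chosen set-theoretic section of `X → G`. -/
noncomputable def sec (g : G) : X := Function.surjInv S.rightHom_surjective g

@[simp]
theorem rightHom_sec (g : G) : S.rightHom (S.sec g) = g :=
  Function.surjInv_eq S.rightHom_surjective g

theorem factorSet_exists (g h : G) : ∃ k : K, S.inl k = S.sec g * S.sec h * (S.sec (g * h))⁻¹ := by
  rw [← MonoidHom.mem_range, S.range_inl_eq_ker_rightHom, MonoidHom.mem_ker]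
  simp

/-- The factor set `f(g, h) = s(g) s(h) s(gh)⁻¹ ∈ K` of the section `s`: a `2`-cocycle that
represents the class of the extension in `H²(G, K)`. -/
noncomputable def factorSet (g h : G) : K := (S.factorSet_exists g h).choose

theorem inl_factorSet (g h : G) :
    S.inl (S.factorSet g h) = S.sec g * S.sec h * (S.sec (g * h))⁻¹ :=
  (S.factorSet_exists g h).choose_spec

variable {S}

theorem factorSet_cocycle (hS : S.IsCentral) (g h j : G) :
    S.factorSet h j * (S.factorSet (g * h) j)⁻¹ * S.factorSet g (h * j) *
      (S.factorSet g h)⁻¹ = 1 := by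
  have hc : ∀ (k : K) (x : X), x * S.inl k = S.inl k * x := fun k x =>
    Subgroup.mem_center_iff.1 (hS ⟨k, rfl⟩) x
  have e : ∀ a b : G, S.sec a * S.sec b = S.inl (S.factorSet a b) * S.sec (a * b) := by
    intro a b
    rw [inl_factorSet]
    group
  have key : S.factorSet g h * S.factorSet (g * h) j = S.factorSet h j * S.factorSet g (h * j) := by
    apply S.inl_injective
    apply mul_right_cancel (b := S.sec (g * h * j))
    have h1 : S.sec g * S.sec h * S.sec j =
        S.inl (S.factorSet g h * S.factorSet (g * h) j) * S.sec (g * h * j) := by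
      rw [e g h, mul_assoc, e (g * h) j, map_mul, mul_assoc (S.inl _)]
    have h2 : S.sec g * (S.sec h * S.sec j) =
        S.inl (S.factorSet h j * S.factorSet g (h * j)) * S.sec (g * h * j) := by
      rw [e h j, ← mul_assoc, hc, mul_assoc, e g (h * j), map_mul, mul_assoc, mul_assoc g h j]
    rw [← h1, ← h2, mul_assoc]
  have : S.factorSet h j * (S.factorSet (g * h) j)⁻¹ * S.factorSet g (h * j) *
      (S.factorSet g h)⁻¹ = (S.factorSet h j * S.factorSet g (h * j)) *
        (S.factorSet g h * S.factorSet (g * h) j)⁻¹ := by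
    rw [mul_inv]
    simp only [mul_comm, mul_left_comm, mul_assoc]
  rw [this, key, mul_inv_cancel]

variable (S)

/-- Evaluation of the factor set on `2`-chains: `∑ n [g|h] ↦ ∑ n f(g, h)`. -/
noncomputable def evalChains : (G × G →₀ ULift.{u} ℤ) →+ Additive K :=
  Finsupp.liftAddHom fun p =>
    ((zmultiplesHom (Additive K)) (Additive.ofMul (S.factorSet p.1 p.2))).comp
      (AddEquiv.ulift (α := ℤ)).toAddMonoidHom

theorem evalChains_single (p : G × G) (n : ULift.{u} ℤ) :
    S.evalChains (Finsupp.single p n) = n.down • Additive.ofMul (S.factorSet p.1 p.2) := by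
  simp [evalChains]
  rfl

/-- Evaluation of the factor set on `2`-cycles. -/
noncomputable def evalCycles :
    groupHomology.cycles₂ (Rep.trivial (ULift.{u} ℤ) G (ULift.{u} ℤ)) →+ Additive K :=
  S.evalChains.comp (Submodule.subtype _).toAddMonoidHom

/-- The projection from `2`-cycles of the inhomogeneous bar complex onto `H₂(G)`. -/
noncomputable def h2Proj (G : Type u) [Group G] :
    groupHomology.cycles₂ (Rep.trivial (ULift.{u} ℤ) G (ULift.{u} ℤ)) →+ IntHomology G 2 :=
  (groupHomology.H2π (Rep.trivial (ULift.{u} ℤ) G (ULift.{u} ℤ))).hom.toAddMonoidHom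

theorem h2Proj_surjective (G : Type u) [Group G] : Function.Surjective (h2Proj G) :=
  (ModuleCat.epi_iff_surjective
    (groupHomology.H2π (Rep.trivial (ULift.{u} ℤ) G (ULift.{u} ℤ)))).1 inferInstance

variable {S}

theorem evalChains_boundary (hS : S.IsCentral) (y : G × G × G →₀ ULift.{u} ℤ) :
    S.evalChains ((groupHomology.d₃₂ (Rep.trivial (ULift.{u} ℤ) G (ULift.{u} ℤ))).hom y) = 0 := by
  induction y using Finsupp.induction_linear with
  | zero => simp
  | add a b ha hb =>
    rw [map_add, map_add]
    erw [ha, hb]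
    simp
  | single p n =>
    have h := groupHomology.d₃₂_single (A := Rep.trivial (ULift.{u} ℤ) G (ULift.{u} ℤ)) p n
    erw [h]
    have h' := congrArg (fun k => n.down • Additive.ofMul k)
      (factorSet_cocycle hS p.1 p.2.1 p.2.2)
    simp only [ofMul_mul, ofMul_inv, ofMul_one, smul_zero, smul_add, smul_neg] at h'
    rw [map_sub, map_add, map_sub]
    simp only [evalChains_single]
    simp only [sub_eq_add_neg]
    exact h'

theorem ker_h2Proj_le (hS : S.IsCentral) : (h2Proj G).ker ≤ S.evalCycles.ker := by
  intro x hx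
  obtain ⟨y, hy⟩ := (groupHomology.H2π_eq_zero_iff x).1 hx
  change S.evalChains x.1 = 0
  rw [← hy]
  exact evalChains_boundary hS y

/-- The differential `μ(f) : H₂(G) → K` of a central extension `f : X ↠ G` of `G` by `K`: the image
of its class under the homomorphism `H²(G, K) → Hom(H₂(G), K)` of the universal coefficient theorem,
that is, evaluation of a representing cocycle on `2`-cycles. -/
noncomputable def differential (S : GroupExtension K X G) (hS : S.IsCentral) :
    IntHomology G 2 →+ Additive K :=
  (h2Proj G).liftOfSurjective (h2Proj_surjective G) ⟨S.evalCycles, ker_h2Proj_le hS⟩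

end GroupExtension

end CentralExtension

/-- An initial extension of `I`: a central extension of `I` by `H_{2∖1}(I)` whose differential is
the localization homomorphism `H₂(I) → H_{2∖1}(I)`. -/
def GroupExtension.IsInitial {I E : Type u} [Group I] [Group E]
    (e : GroupExtension (Multiplicative (H2Minus1 I)) E I) : Prop :=
  ∃ he : e.IsCentral, ∀ x : IntHomology I 2,
    (e.differential he x).toMul = Multiplicative.ofAdd (H2Minus1.loc I x)

section GeneralizedSubgroup

/-- A homomorphism `a : X → G` is a generalized subgroup of `G` if
`Hom(X, a) : Hom(X, X) → Hom(X, G)` is injective. -/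
def IsGeneralizedSubgroup {X G : Type u} [Group X] [Group G] (a : X →* G) : Prop :=
  Function.Injective fun f : X →* X => a.comp f

/-- Surjective generalized subgroups `X ↠ G`. -/
structure SurjGenSubgroup (G : Type u) [Group G] where
  /-- the source -/
  X : Type u
  [group : Group X]
  /-- the homomorphism -/
  hom : X →* G
  surjective : Function.Surjective hom
  isGen : IsGeneralizedSubgroup hom

attribute [instance] SurjGenSubgroup.group

namespace SurjGenSubgroup

variable {G : Type u} [Group G]

/-- `a : X ↠ G` and `b : Y ↠ G` are equivalent if `b h = a` for an isomorphism `h : X ≅ Y`. -/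
instance setoid (G : Type u) [Group G] : Setoid (SurjGenSubgroup G) where
  r a b := ∃ h : a.X ≃* b.X, b.hom.comp h.toMonoidHom = a.hom
  iseqv :=
    { refl := fun a => ⟨MulEquiv.refl _, rfl⟩
      symm := by
        rintro a b ⟨h, hh⟩
        refine ⟨h.symm, ?_⟩
        rw [← hh]
        ext x
        simp
      trans := by
        rintro a b c ⟨h, hh⟩ ⟨k, hk⟩
        refine ⟨h.trans k, ?_⟩
        rw [← hh, ← hk]
        rfl }

theorem ker_le_center (a : SurjGenSubgroup G) : a.hom.ker ≤ Subgroup.center a.X := by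
  intro x hx
  have h : (MulAut.conj x).toMonoidHom = MonoidHom.id a.X := by
    apply a.isGen
    ext y
    simp [MonoidHom.mem_ker.1 hx]
  rw [Subgroup.mem_center_iff]
  intro y
  have := DFunLike.congr_fun h y
  simp only [MulEquiv.toMonoidHom_eq_coe, MonoidHom.coe_coe, MulAut.conj_apply,
    MonoidHom.id_apply] at this
  exact (mul_inv_eq_iff_eq_mul.1 this).symm

instance kerCommGroup (a : SurjGenSubgroup G) : CommGroup a.hom.ker :=
  { (inferInstance : Group a.hom.ker) with
    mul_comm := fun x y => Subtype.ext
      (Subgroup.mem_center_iff.1 (a.ker_le_center y.2) x.1) }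

/-- The central extension `1 → Ker(a) → X → G → 1` given by `a : X ↠ G`. -/
def extension (a : SurjGenSubgroup G) : GroupExtension a.hom.ker a.X G where
  inl := a.hom.ker.subtype
  rightHom := a.hom
  inl_injective := Subtype.val_injective
  range_inl_eq_ker_rightHom := a.hom.ker.range_subtype
  rightHom_surjective := a.surjective

theorem extension_isCentral (a : SurjGenSubgroup G) : a.extension.IsCentral := by
  intro x hx
  apply a.ker_le_center
  rw [← a.hom.ker.range_subtype]
  exact hx

/-- The differential `μ(a) : H₂(G) → Ker(a)`. -/
noncomputable def differential (a : SurjGenSubgroup G) :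
    IntHomology G 2 →+ Additive a.hom.ker :=
  a.extension.differential a.extension_isCentral

/-- `σ : H_{2∖1}(G) → Ker(a)` is the factorization of `μ(a)` through the localization
`H₂(G) → H_{2∖1}(G)`. -/
def IsLocalizedDifferential (a : SurjGenSubgroup G) (σ : H2Minus1 G →+ Additive a.hom.ker) : Prop :=
  σ.comp (H2Minus1.loc G) = a.differential

end SurjGenSubgroup

/-- The collection of equivalence classes of surjective generalized subgroups of `G`. -/
def SurGenSub (G : Type u) [Group G] : Type (u + 1) := Quotient (SurjGenSubgroup.setoid G)

end GeneralizedSubgroup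

/-- Surjections `A ↠ K` out of an abelian group `A`. -/
structure AbSurjection (A : Type u) [AddCommGroup A] where
  /-- the target -/
  K : Type u
  [group : AddCommGroup K]
  /-- the homomorphism -/
  hom : A →+ K
  surjective : Function.Surjective hom

attribute [instance] AbSurjection.group

/-- `σ : A ↠ K` and `τ : A ↠ L` are equivalent if `h σ = τ` for an isomorphism `h : K ≅ L`. -/
instance AbSurjection.setoid (A : Type u) [AddCommGroup A] : Setoid (AbSurjection A) where
  r σ τ := ∃ h : σ.K ≃+ τ.K, h.toAddMonoidHom.comp σ.hom = τ.hom
  iseqv :=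
    { refl := fun a => ⟨AddEquiv.refl _, rfl⟩
      symm := by
        rintro a b ⟨h, hh⟩
        refine ⟨h.symm, ?_⟩
        rw [← hh]
        ext x
        simp
      trans := by
        rintro a b c ⟨h, hh⟩ ⟨k, hk⟩
        refine ⟨h.trans k, ?_⟩
        rw [← hk, ← hh]
        rfl }

/-- `Quot(A)`: the equivalence classes of surjections out of `A`. -/
def QuotSet (A : Type u) [AddCommGroup A] : Type (u + 1) := Quotient (AbSurjection.setoid A)

/-! Everything rests on the universal coefficient sequence 0 → Ext(H₁, K) → H²(G, K) → Hom(H₂, K) →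
0, realized by hand with factor sets evaluated on bar cycles. For finite G every map H₂ → K is a
differential (`exists_differential_eq`). If |H₁| acts invertibly on K, the Ext term vanishes, so
compatibility with differentials suffices to lift a map of kernels to a map of central extensions
(`exists_hom_of_differential`). The image of the differential is K ∩ [X, X]
(`inl_mem_commutator_iff`).

A surjection a : X ↠ I with kernel K is a generalized subgroup exactly when K is central and Hom(X,
K) = 0. The transfer X → K is then trivial, but it is also x ↦ x^|I|; hence K and the abelianization
of X have bounded exponent. For such groups Hom(Xᵃᵇ, K) = 0 separates primes: for each p, either Xᵃᵇ
is p-divisible or K has no p-torsion. This forces the image of K in Xᵃᵇ to vanish, so K ≤ [X, X] and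
the differential is surjective. It also forces K to be S-local, since Xᵃᵇ maps onto Iᵃᵇ, which is
not p-divisible for p in S.

Conversely, a quotient L of H_{2∖1}(I) is S-local, and the extension with differential H₂ → H_{2∖1}
→ L has L ≤ [X, X]. Maps X → L therefore factor through Iᵃᵇ and vanish. Bijectivity, uniqueness of
the initial extension and the push-out square all follow from lifting along differentials. -/

section BarChains

/-! ### Bar chains, evaluation of cochains, and the universal coefficient theorem in degree two. -/

variable (G : Type u) [Group G]

/-- The differential `[g|h] ↦ [h] - [gh] + [g]` of the bar complex with trivial coefficients. -/
noncomputable def barD2 : (G × G →₀ ULift.{u} ℤ) →ₗ[ULift.{u} ℤ] (G →₀ ULift.{u} ℤ) :=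
  (groupHomology.d₂₁ (Rep.trivial (ULift.{u} ℤ) G (ULift.{u} ℤ))).hom

/-- The differential `[g|h|j] ↦ [h|j] - [gh|j] + [g|hj] - [g|h]` of the bar complex with trivial
coefficients. -/
noncomputable def barD3 : (G × G × G →₀ ULift.{u} ℤ) →ₗ[ULift.{u} ℤ] (G × G →₀ ULift.{u} ℤ) :=
  (groupHomology.d₃₂ (Rep.trivial (ULift.{u} ℤ) G (ULift.{u} ℤ))).hom

variable {G}

theorem barD2_single (p : G × G) (n : ULift.{u} ℤ) :
    barD2 G (Finsupp.single p n) =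
      Finsupp.single p.2 n - Finsupp.single (p.1 * p.2) n + Finsupp.single p.1 n :=
  groupHomology.d₂₁_single (A := Rep.trivial (ULift.{u} ℤ) G (ULift.{u} ℤ)) p n

theorem barD3_single (p : G × G × G) (n : ULift.{u} ℤ) :
    barD3 G (Finsupp.single p n) =
      Finsupp.single (p.2.1, p.2.2) n - Finsupp.single (p.1 * p.2.1, p.2.2) n +
        Finsupp.single (p.1, p.2.1 * p.2.2) n - Finsupp.single (p.1, p.2.1) n :=
  groupHomology.d₃₂_single (A := Rep.trivial (ULift.{u} ℤ) G (ULift.{u} ℤ)) p n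

theorem barD2_barD3 (y : G × G × G →₀ ULift.{u} ℤ) : barD2 G (barD3 G y) = 0 :=
  groupHomology.d₃₂_apply_mem_cycles₂ (A := Rep.trivial (ULift.{u} ℤ) G (ULift.{u} ℤ)) y

/-- The class in `H₂(G)` of a `2`-cycle of the bar complex. -/
noncomputable def h2Class (z : G × G →₀ ULift.{u} ℤ) (hz : barD2 G z = 0) : IntHomology G 2 :=
  GroupExtension.h2Proj G ⟨z, hz⟩

theorem exists_h2Class_eq (x : IntHomology G 2) : ∃ z hz, h2Class (G := G) z hz = x := by
  obtain ⟨⟨z, hz⟩, h⟩ := GroupExtension.h2Proj_surjective G x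
  exact ⟨z, hz, h⟩

theorem h2Class_barD3 (y : G × G × G →₀ ULift.{u} ℤ) :
    h2Class (barD3 G y) (barD2_barD3 y) = 0 :=
  (groupHomology.H2π_eq_zero_iff _).2 ⟨y, rfl⟩

/-- The class in `H₁(G)` of a `1`-chain of the bar complex. -/
noncomputable def h1Class (G : Type u) [Group G] : (G →₀ ULift.{u} ℤ) →+ IntHomology G 1 :=
  ((groupHomology.H1π (Rep.trivial (ULift.{u} ℤ) G (ULift.{u} ℤ))).hom.toAddMonoidHom).comp
    (LinearMap.codRestrict (groupHomology.cycles₁ (Rep.trivial (ULift.{u} ℤ) G (ULift.{u} ℤ)))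
      LinearMap.id fun x => by
        rw [groupHomology.cycles₁_eq_top_of_isTrivial]; trivial).toAddMonoidHom

theorem mem_range_barD2_of_h1Class_eq_zero (x : G →₀ ULift.{u} ℤ) (hx : h1Class G x = 0) :
    x ∈ LinearMap.range (barD2 G) :=
  (groupHomology.H1π_eq_zero_iff _).1 hx

/-- With trivial coefficients every 1-chain is a cycle, so this is Lagrange in H₁; for infinite H₁
the multiple is by `Nat.card` = 0. -/
theorem nsmul_card_H1_mem_range (x : G →₀ ULift.{u} ℤ) :
    Nat.card (IntHomology G 1) • x ∈ LinearMap.range (barD2 G) := by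
  apply mem_range_barD2_of_h1Class_eq_zero
  rw [map_nsmul]
  generalize h1Class G x = y
  exact card_nsmul_eq_zero'

section Eval

variable {α A B : Type*} [AddCommGroup A] [AddCommGroup B]

/-- The additive extension of `f : α → A` to formal integral combinations. -/
noncomputable def evalAt (f : α → A) : (α →₀ ULift.{u} ℤ) →+ A :=
  Finsupp.liftAddHom fun p =>
    ((zmultiplesHom A) (f p)).comp (AddEquiv.ulift (α := ℤ)).toAddMonoidHom

theorem evalAt_single (f : α → A) (p : α) (n : ULift.{u} ℤ) :
    evalAt f (Finsupp.single p n) = n.down • f p := by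
  simp [evalAt]
  rfl

theorem addHom_finsupp_ext {g h : (α →₀ ULift.{u} ℤ) →+ A}
    (H : ∀ p, g (Finsupp.single p 1) = h (Finsupp.single p 1)) : g = h := by
  refine Finsupp.addHom_ext fun p n => ?_
  have : Finsupp.single p n = n.down • (Finsupp.single p (1 : ULift.{u} ℤ)) := by
    rw [Finsupp.smul_single]
    congr 1
    ext
    simp
  rw [this, map_zsmul, map_zsmul, H]

theorem evalAt_single_one (f : α → A) (p : α) :
    evalAt f (Finsupp.single p (1 : ULift.{u} ℤ)) = f p := by
  rw [evalAt_single]; simp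

theorem evalAt_map (f : α → A) (φ : A →+ B) (x : α →₀ ULift.{u} ℤ) :
    evalAt (fun p => φ (f p)) x = φ (evalAt f x) := by
  refine DFunLike.congr_fun (f := evalAt _) (g := φ.comp (evalAt f)) (addHom_finsupp_ext ?_) x
  simp [evalAt_single_one]

theorem evalAt_sub (f f' : α → A) (x : α →₀ ULift.{u} ℤ) :
    evalAt (fun p => f p - f' p) x = evalAt f x - evalAt f' x := by
  refine DFunLike.congr_fun (f := evalAt _) (g := evalAt f - evalAt f') (addHom_finsupp_ext ?_) x
  simp [evalAt_single_one]

/-- The coboundary `(g, h) ↦ ψ(g) + ψ(h) - ψ(gh)` of a `1`-cochain. -/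
def coboundary (ψ : G → A) (p : G × G) : A := ψ p.1 + ψ p.2 - ψ (p.1 * p.2)

theorem evalAt_coboundary (ψ : G → A) (x : G × G →₀ ULift.{u} ℤ) :
    evalAt (coboundary ψ) x = evalAt ψ (barD2 G x) := by
  refine DFunLike.congr_fun (f := evalAt _)
    (g := (evalAt ψ).comp (barD2 G).toAddMonoidHom) (addHom_finsupp_ext fun p => ?_) x
  simp only [AddMonoidHom.comp_apply, LinearMap.toAddMonoidHom_coe, barD2_single, map_add, map_sub,
    evalAt_single_one, coboundary]
  abel

/-- A cochain that vanishes on cycles factors through the boundary map. -/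
theorem exists_factor_of_evalAt_eq_zero (f : G × G → A)
    (hf : ∀ z : G × G →₀ ULift.{u} ℤ, barD2 G z = 0 → evalAt f z = 0) :
    ∃ ψ : LinearMap.range (barD2 G) →+ A,
      ∀ x, ψ ⟨barD2 G x, LinearMap.mem_range_self _ x⟩ = evalAt f x := by
  have hs : Function.Surjective (barD2 G).rangeRestrict.toAddMonoidHom :=
    (barD2 G).surjective_rangeRestrict
  refine ⟨AddMonoidHom.liftOfSurjective _ hs ⟨evalAt f, fun z hz => ?_⟩, fun x => ?_⟩
  · exact hf z (congrArg Subtype.val (AddMonoidHom.mem_ker.1 hz))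
  · exact AddMonoidHom.liftOfRightInverse_comp_apply _ _ _ ⟨evalAt f, _⟩ x

/-- A cochain with values in `ℚ/ℤ` that vanishes on cycles is a coboundary. -/
theorem exists_coboundary_character (f : G × G → AddCircle (1 : ℚ))
    (hf : ∀ z : G × G →₀ ULift.{u} ℤ, barD2 G z = 0 → evalAt f z = 0) :
    ∃ ψ : G → AddCircle (1 : ℚ), f = coboundary ψ := by
  obtain ⟨ψ, hψ⟩ := exists_factor_of_evalAt_eq_zero f hf
  -- ℚ/ℤ is injective, so the character of the 1-boundaries extends to all 1-chains; its values on
  -- the basis give the cochain.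
  obtain ⟨Ψ, hΨ⟩ := CharacterModule.dual_surjective_of_injective
    (LinearMap.range (barD2 G)).subtype (Submodule.injective_subtype _) ψ
  refine ⟨fun g => Ψ (Finsupp.single g 1), funext fun p => ?_⟩
  have h := hψ (Finsupp.single p 1)
  rw [evalAt_single_one, ← hΨ] at h
  rw [← h]
  change Ψ (barD2 G _) = _
  rw [barD2_single, map_add, map_sub, coboundary]
  abel

/-- If the order of `H₁(G)` is invertible on `A`, a cochain with values in `A` that vanishes on
cycles is a coboundary. -/
theorem exists_coboundary_of_bijective (f : G × G → A)
    (hA : Function.Bijective fun a : A => Nat.card (IntHomology G 1) • a)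
    (hf : ∀ z : G × G →₀ ULift.{u} ℤ, barD2 G z = 0 → evalAt f z = 0) :
    ∃ ψ : G → A, f = coboundary ψ := by
  obtain ⟨ψ, hψ⟩ := exists_factor_of_evalAt_eq_zero f hf
  -- With n = |H₁|, the chain n[g] is a boundary, so θ(g) = ψ(n[g])/n makes sense.
  choose θ hθ using fun g => hA.2 (ψ ⟨_, nsmul_card_H1_mem_range (Finsupp.single g 1)⟩)
  refine ⟨θ, funext fun p => hA.1 ?_⟩
  simp only [coboundary, smul_sub, smul_add] at hθ ⊢
  rw [hθ, hθ, hθ, ← evalAt_single_one f p, ← hψ, ← map_nsmul, ← map_add, ← map_sub]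
  congr 1
  ext1
  simp only [Submodule.coe_sub, Submodule.coe_add, Submodule.coe_smul_of_tower, barD2_single,
    smul_sub, smul_add]
  abel

end Eval

instance : IsDomain (ULift.{u} ℤ) := (ULift.ringEquiv (R := ℤ)).toMulEquiv.isDomain ℤ

instance : IsPrincipalIdealRing (ULift.{u} ℤ) :=
  IsPrincipalIdealRing.of_surjective (ULift.ringEquiv (R := ℤ)).symm.toRingHom
    (ULift.ringEquiv (R := ℤ)).symm.surjective

/-- The boundaries form a submodule of a free module over a PID, hence are free, so ∂ splits over
its image by some t; the retraction is x ↦ x - t∂x. -/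
theorem exists_retraction_cycles (G : Type u) [Group G] [Finite G] :
    ∃ r : (G × G →₀ ULift.{u} ℤ) →ₗ[ULift.{u} ℤ] LinearMap.ker (barD2 G),
      ∀ z (hz : barD2 G z = 0), r z = ⟨z, hz⟩ := by
  obtain ⟨n, ⟨b⟩⟩ := Submodule.nonempty_basis_of_pid
    (Finsupp.basisSingleOne (R := ULift.{u} ℤ) (ι := G)) (LinearMap.range (barD2 G))
  have := Module.Projective.of_basis b
  obtain ⟨t, ht⟩ := Module.projective_lifting_property (barD2 G).rangeRestrict LinearMap.id
    (barD2 G).surjective_rangeRestrict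
  have ht' : ∀ x, barD2 G (t ((barD2 G).rangeRestrict x)) = barD2 G x := fun x =>
    congrArg Subtype.val (LinearMap.congr_fun ht ((barD2 G).rangeRestrict x))
  refine ⟨(LinearMap.id - t ∘ₗ (barD2 G).rangeRestrict).codRestrict _ fun x => ?_, ?_⟩
  · intro z hz
    have : (barD2 G).rangeRestrict z = 0 := Subtype.ext hz
    refine Subtype.ext ?_
    rw [LinearMap.codRestrict_apply, LinearMap.sub_apply, LinearMap.comp_apply, this, map_zero,
      sub_zero, LinearMap.id_apply]
  · rw [LinearMap.mem_ker, LinearMap.sub_apply, map_sub, LinearMap.comp_apply, ht',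
      LinearMap.id_apply, sub_self]

/-- Every homomorphism out of `H₂(G)` is evaluation of a `2`-cocycle. -/
theorem exists_cocycle_of_hom [Finite G] {A : Type*} [AddCommGroup A] (φ : IntHomology G 2 →+ A) :
    ∃ f : G × G → A,
      (∀ g h j, f (h, j) - f (g * h, j) + f (g, h * j) - f (g, h) = 0) ∧
      ∀ z hz, evalAt f z = φ (h2Class z hz) := by
  obtain ⟨r, hr⟩ := exists_retraction_cycles G
  -- Retract chains to cycles, take the class, apply φ. The resulting cochain is a cocycle because
  -- boundaries have class zero.
  let F : (G × G →₀ ULift.{u} ℤ) →+ A :=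
    (φ.comp (GroupExtension.h2Proj G)).comp r.toAddMonoidHom
  have hF : evalAt (fun p => F (Finsupp.single p 1)) = F :=
    addHom_finsupp_ext fun p => evalAt_single_one _ p
  have hF' : ∀ z hz, F z = φ (h2Class z hz) := fun z hz =>
    congrArg (fun w => φ (GroupExtension.h2Proj G w)) (hr z hz)
  refine ⟨fun p => F (Finsupp.single p 1), fun g h j => ?_, fun z hz => ?_⟩
  · have := hF' _ (barD2_barD3 (Finsupp.single (g, h, j) 1))
    rw [h2Class_barD3, map_zero, barD3_single, map_sub, map_add, map_sub] at this
    exact this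
  · rw [hF, hF' z hz]

theorem evalAt_ext_on_cycles {A : Type*} [AddCommGroup A] {φ φ' : IntHomology G 2 →+ A}
    (H : ∀ z hz, φ (h2Class z hz) = φ' (h2Class z hz)) : φ = φ' := by
  ext x
  obtain ⟨z, hz, rfl⟩ := exists_h2Class_eq x
  exact H z hz

/-- The order of a finite group annihilates its second homology. -/
theorem card_nsmul_H2 [Finite G] (x : IntHomology G 2) : Nat.card G • x = 0 := by
  have := Fintype.ofFinite G
  -- Averaging homotopy: with H and H' summing over all possible new first entries, ∂H = |G| - H'∂,
  -- because g ↦ gp₁ permutes G.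
  let H : (G × G →₀ ULift.{u} ℤ) →+ (G × G × G →₀ ULift.{u} ℤ) :=
    evalAt fun p => ∑ g : G, Finsupp.single (g, p.1, p.2) 1
  let H' : (G →₀ ULift.{u} ℤ) →+ (G × G →₀ ULift.{u} ℤ) :=
    evalAt fun p => ∑ g : G, Finsupp.single (g, p) 1
  have key : (barD3 G).toAddMonoidHom.comp H =
      Nat.card G • AddMonoidHom.id _ - H'.comp (barD2 G).toAddMonoidHom := by
    refine addHom_finsupp_ext fun p => ?_
    simp only [AddMonoidHom.comp_apply, LinearMap.toAddMonoidHom_coe, AddMonoidHom.sub_apply,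
      AddMonoidHom.smul_apply, AddMonoidHom.id_apply, H, H', evalAt_single_one, barD2_single,
      map_sub, map_add, map_sum, barD3_single, Finset.sum_sub_distrib, Finset.sum_add_distrib]
    rw [Fintype.sum_equiv (Equiv.mulRight p.1)
      (fun g => Finsupp.single (g * p.1, p.2) (1 : ULift.{u} ℤ)) (fun g => Finsupp.single (g, p.2) 1)
      (fun g => rfl)]
    simp only [Finset.sum_const, Finset.card_univ, Nat.card_eq_fintype_card]
    abel
  obtain ⟨z, hz, rfl⟩ := exists_h2Class_eq x
  have hz' : barD3 G (H z) = Nat.card G • z := by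
    have := DFunLike.congr_fun key z
    simpa [hz] using this
  have h0 := h2Class_barD3 (H z)
  have e : Nat.card G • h2Class z hz = h2Class (barD3 G (H z)) (barD2_barD3 _) := by
    rw [h2Class, ← map_nsmul]
    refine congrArg (GroupExtension.h2Proj G) (Subtype.ext hz'.symm)
  rw [e, h0]

end BarChains

/-! ### Differentials and morphisms of central extensions. -/

namespace GroupExtension

variable {K K' X X' G : Type u} [CommGroup K] [CommGroup K'] [Group X] [Group X'] [Group G]
variable (S : GroupExtension K X G) (S' : GroupExtension K' X' G)

theorem sec_mul_sec (g h : G) : S.sec g * S.sec h = S.inl (S.factorSet g h) * S.sec (g * h) := by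
  rw [inl_factorSet]; group

theorem exists_inl_mul_eq {x y : X} (h : S.rightHom x = S.rightHom y) : ∃ k, x = S.inl k * y := by
  have : x * y⁻¹ ∈ S.rightHom.ker := by simp [MonoidHom.mem_ker, h]
  rw [← S.range_inl_eq_ker_rightHom] at this
  obtain ⟨k, hk⟩ := this
  exact ⟨k, by rw [hk]; group⟩

theorem exists_eq_inl_mul_sec (x : X) : ∃ k, x = S.inl k * S.sec (S.rightHom x) :=
  S.exists_inl_mul_eq (by simp)

variable {S S'}

theorem IsCentral.comm (hS : S.IsCentral) (k : K) (x : X) : x * S.inl k = S.inl k * x :=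
  Subgroup.mem_center_iff.1 (hS ⟨k, rfl⟩) x

theorem differential_h2Proj (hS : S.IsCentral)
    (z : groupHomology.cycles₂ (Rep.trivial (ULift.{u} ℤ) G (ULift.{u} ℤ))) :
    S.differential hS (h2Proj G z) = S.evalCycles z := by
  have h := AddMonoidHom.liftOfRightInverse_comp_apply (h2Proj G)
    (Function.surjInv (h2Proj_surjective G)) (Function.rightInverse_surjInv (h2Proj_surjective G))
    ⟨S.evalCycles, ker_h2Proj_le hS⟩ z
  exact h

theorem differential_h2Class (hS : S.IsCentral) (z : G × G →₀ ULift.{u} ℤ) (hz : barD2 G z = 0) :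
    S.differential hS (h2Class z hz) =
      evalAt (fun p : G × G => Additive.ofMul (S.factorSet p.1 p.2)) z := by
  rw [h2Class, differential_h2Proj hS]
  rfl

/-- The differential may be computed with the factor set of an arbitrary section. -/
theorem differential_eq_of_section (hS : S.IsCentral) (s : G → X) (hs : ∀ g, S.rightHom (s g) = g)
    (f : G × G → K) (hf : ∀ g h, s g * s h = S.inl (f (g, h)) * s (g * h))
    (z) (hz : barD2 G z = 0) :
    S.differential hS (h2Class z hz) = evalAt (fun p : G × G => Additive.ofMul (f p)) z := by
  -- Two sections differ by a 1-cochain c, so their factor sets differ by its coboundary, which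
  -- evaluates to zero on cycles.
  choose c hc using fun g => S.exists_inl_mul_eq (x := s g) (y := S.sec g) (by simp [hs])
  have key : (fun p : G × G => Additive.ofMul (f p) - Additive.ofMul (S.factorSet p.1 p.2)) =
      coboundary fun g => Additive.ofMul (c g) := by
    funext ⟨g, h⟩
    have h1 : f (g, h) * c (g * h) = c g * c h * S.factorSet g h := by
      apply S.inl_injective
      apply mul_right_cancel (b := S.sec (g * h))
      have := hf g h
      rw [hc g, hc h, hc (g * h)] at this
      calc S.inl (f (g, h) * c (g * h)) * S.sec (g * h)
          = S.inl (c g) * S.sec g * (S.inl (c h) * S.sec h) := by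
            rw [this, map_mul, mul_assoc]
        _ = S.inl (c g) * (S.sec g * S.inl (c h)) * S.sec h := by group
        _ = S.inl (c g * c h) * (S.sec g * S.sec h) := by
            rw [hS.comm, map_mul]; group
        _ = _ := by rw [sec_mul_sec, map_mul _ (c g * c h), mul_assoc]
    rw [coboundary, sub_eq_sub_iff_add_eq_add]
    exact congrArg Additive.ofMul h1
  rw [differential_h2Class, eq_comm, ← sub_eq_zero, ← evalAt_sub, key, evalAt_coboundary, hz,
    map_zero]

/-- The differential is natural with respect to morphisms of central extensions of `G`. -/
theorem differential_natural (hS : S.IsCentral) (hS' : S'.IsCentral) (π : X →* X') (κ : K →* K')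
    (hκ : ∀ k, π (S.inl k) = S'.inl (κ k)) (hπ : ∀ x, S'.rightHom (π x) = S.rightHom x)
    (x : IntHomology G 2) :
    S'.differential hS' x = MonoidHom.toAdditive κ (S.differential hS x) := by
  obtain ⟨z, hz, rfl⟩ := exists_h2Class_eq x
  -- The image under π of a section of S is a section of S', with factor set the image under κ.
  rw [differential_h2Class hS, differential_eq_of_section hS' (fun g => π (S.sec g))
    (fun g => by simp [hπ]) (fun p => κ (S.factorSet p.1 p.2))
    (fun g h => by rw [← map_mul, sec_mul_sec, map_mul, hκ]), ← evalAt_map]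
  rfl

/-- Homomorphisms out of a central extension, described on the kernel and on a section. -/
theorem exists_hom_of_factorSet (hS : S.IsCentral) {T : Type*} [Group T] (v : K →* T) (w : G → T)
    (hvw : ∀ k g, w g * v k = v k * w g)
    (hw : ∀ g h, w g * w h = v (S.factorSet g h) * w (g * h)) :
    ∃ π : X →* T, (∀ k, π (S.inl k) = v k) ∧ ∀ k g, π (S.inl k * S.sec g) = v k * w g := by
  choose κ hκ using S.exists_eq_inl_mul_sec
  have hκ' : ∀ k g, κ (S.inl k * S.sec g) = k := fun k g => by
    have := hκ (S.inl k * S.sec g)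
    simp only [map_mul, rightHom_inl, one_mul, rightHom_sec] at this
    exact (S.inl_injective (mul_right_cancel this)).symm
  have hmul : ∀ x y, κ (x * y) = κ x * κ y * S.factorSet (S.rightHom x) (S.rightHom y) :=
    fun x y => by
      rw [← hκ' (κ x * κ y * S.factorSet (S.rightHom x) (S.rightHom y))
        (S.rightHom x * S.rightHom y)]
      congr 1
      rw [map_mul _ (κ x * κ y), mul_assoc, ← sec_mul_sec]
      conv_lhs => rw [hκ x, hκ y]
      calc _ = S.inl (κ x) * (S.sec (S.rightHom x) * S.inl (κ y)) * S.sec (S.rightHom y) := by group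
        _ = _ := by rw [hS.comm, map_mul]; group
  let π : X →* T := MonoidHom.mk' (fun x => v (κ x) * w (S.rightHom x)) fun x y => by
    rw [hmul, map_mul, map_mul, map_mul, mul_assoc, ← hw]
    calc _ = v (κ x) * (v (κ y) * w (S.rightHom x)) * w (S.rightHom y) := by group
      _ = _ := by rw [← hvw]; group
  have hπ : ∀ k g, π (S.inl k * S.sec g) = v k * w g := fun k g => by
    change v (κ _) * w (S.rightHom _) = _
    rw [hκ', map_mul, rightHom_inl, one_mul, rightHom_sec]
  refine ⟨π, fun k => ?_, hπ⟩
  -- The section need not send 1 to 1, so the value on the kernel is found by cancelling the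
  -- contribution of `S.sec 1`.
  have h1 : π (S.sec 1) = w 1 := by simpa using hπ 1 1
  have h2 := hπ k 1
  rw [map_mul, h1] at h2
  exact mul_right_cancel h2

/-- If the order of `H₁(G)` is invertible on `K'`, a homomorphism `K → K'` compatible with the
differentials extends to a morphism of central extensions of `G`. -/
theorem exists_hom_of_differential (hS : S.IsCentral) (hS' : S'.IsCentral)
    (hK' : Function.Bijective fun a : Additive K' => Nat.card (IntHomology G 1) • a) (κ : K →* K')
    (h : ∀ x, S'.differential hS' x = MonoidHom.toAdditive κ (S.differential hS x)) :
    ∃ π : X →* X', (∀ k, π (S.inl k) = S'.inl (κ k)) ∧ ∀ x, S'.rightHom (π x) = S.rightHom x := by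
  -- The pushed-forward factor set and that of S' agree on cycles, hence differ by the coboundary of
  -- some ψ; correcting the section of S' by ψ makes the factor sets equal.
  obtain ⟨ψ, hψ⟩ := exists_coboundary_of_bijective
    (fun p : G × G => MonoidHom.toAdditive κ (Additive.ofMul (S.factorSet p.1 p.2)) -
      Additive.ofMul (S'.factorSet p.1 p.2)) hK' fun z hz => by
        rw [evalAt_sub, evalAt_map, ← differential_h2Class hS z hz,
          ← differential_h2Class hS' z hz, h, sub_self]
  have hψ' : ∀ g h, (ψ g).toMul * (ψ h).toMul * S'.factorSet g h =
      κ (S.factorSet g h) * (ψ (g * h)).toMul := fun g h => by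
    have := congrArg Additive.toMul (congrFun hψ (g, h))
    change κ (S.factorSet g h) / S'.factorSet g h = (ψ g).toMul * (ψ h).toMul / (ψ (g * h)).toMul
      at this
    rw [div_eq_div_iff_mul_eq_mul] at this
    rw [this]
  obtain ⟨π, h1, h2⟩ := exists_hom_of_factorSet hS (S'.inl.comp κ)
    (fun g => S'.inl (ψ g).toMul * S'.sec g)
    (fun k g => by
      rw [mul_assoc]
      simp only [MonoidHom.comp_apply]
      rw [hS'.comm, ← mul_assoc, ← mul_assoc, ← map_mul, ← map_mul, mul_comm])
    (fun g h => by
      simp only [MonoidHom.comp_apply]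
      rw [← mul_assoc _ _ (S'.sec (g * h)), ← map_mul, ← hψ', map_mul _ (_ * _), mul_assoc _ _
        (S'.sec (g * h)), ← sec_mul_sec, map_mul]
      calc _ = S'.inl (ψ g).toMul * (S'.sec g * S'.inl (ψ h).toMul) * S'.sec h := by group
        _ = _ := by rw [hS'.comm]; group)
  refine ⟨π, h1, fun x => ?_⟩
  obtain ⟨k, hk⟩ := S.exists_eq_inl_mul_sec x
  rw [hk, h2]
  simp

/-- The short five lemma. -/
theorem bijective_of_morphism (π : X →* X') (κ : K →* K')
    (h1 : ∀ k, π (S.inl k) = S'.inl (κ k)) (h2 : ∀ x, S'.rightHom (π x) = S.rightHom x)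
    (hκ : Function.Bijective κ) : Function.Bijective π := by
  refine ⟨(injective_iff_map_eq_one π).2 fun x hx => ?_, fun y => ?_⟩
  · have : x ∈ S.rightHom.ker := by rw [MonoidHom.mem_ker, ← h2, hx, map_one]
    rw [← S.range_inl_eq_ker_rightHom] at this
    obtain ⟨k, rfl⟩ := this
    rw [h1] at hx
    rw [hκ.1 (S'.inl_injective (hx.trans (by simp)) : κ k = κ 1), map_one]
  · obtain ⟨x, hx⟩ := S.rightHom_surjective (S'.rightHom y)
    obtain ⟨k', hk'⟩ := S'.exists_inl_mul_eq (x := y) (y := π x) (by rw [h2, hx])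
    obtain ⟨k, rfl⟩ := hκ.2 k'
    exact ⟨S.inl k * x, by rw [hk', map_mul, h1]⟩

/-- The image of the differential is `K ∩ [X, X]`. -/
theorem inl_mem_commutator_iff (hS : S.IsCentral) (k : K) :
    S.inl k ∈ commutator X ↔ ∃ x, S.differential hS x = Additive.ofMul k := by
  constructor
  · intro hk
    -- Otherwise some ℚ/ℤ-character of K kills the image of the differential but not k. It turns the
    -- factor set into a coboundary, so it extends to a character of X, which must kill commutators.
    by_contra hne
    have hne' : (QuotientAddGroup.mk' (S.differential hS).range) (Additive.ofMul k) ≠ 0 := by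
      rw [QuotientAddGroup.mk'_apply, Ne, QuotientAddGroup.eq_zero_iff]
      exact hne
    obtain ⟨χ, hχ⟩ := CharacterModule.exists_character_apply_ne_zero_of_ne_zero hne'
    let c : Additive K →+ AddCircle (1 : ℚ) :=
      AddMonoidHom.comp χ (QuotientAddGroup.mk' (S.differential hS).range)
    have hc : ∀ x, c (S.differential hS x) = 0 := fun x => by
      have : (QuotientAddGroup.mk' (S.differential hS).range) (S.differential hS x) = 0 :=
        (QuotientAddGroup.eq_zero_iff _).2 ⟨x, rfl⟩
      change χ _ = 0
      rw [this]
      exact map_zero χ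
    obtain ⟨ψ, hψ⟩ := exists_coboundary_character
      (fun p : G × G => c (Additive.ofMul (S.factorSet p.1 p.2))) fun z hz => by
        rw [evalAt_map, ← differential_h2Class hS z hz, hc]
    obtain ⟨π, h1, -⟩ := exists_hom_of_factorSet (T := Multiplicative (AddCircle (1 : ℚ))) hS
      (AddMonoidHom.toMultiplicativeRight c) (fun g => Multiplicative.ofAdd (ψ g))
      (fun _ _ => mul_comm _ _) fun g h => by
        have := congrFun hψ (g, h)
        exact congrArg Multiplicative.ofAdd (eq_sub_iff_add_eq.1 this).symm
    have h2 := Abelianization.commutator_subset_ker π hk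
    rw [MonoidHom.mem_ker, h1] at h2
    exact hχ h2
  · rintro ⟨x, hx⟩
    obtain ⟨z, hz, rfl⟩ := exists_h2Class_eq x
    -- In the abelianization of X the factor set becomes the coboundary of the section, hence
    -- vanishes on cycles.
    let a : Additive K →+ Additive (Abelianization X) :=
      MonoidHom.toAdditive (Abelianization.of.comp S.inl)
    have h : a (Additive.ofMul k) = 0 := by
      rw [← hx, differential_h2Class, ← evalAt_map]
      have : (fun p : G × G => a (Additive.ofMul (S.factorSet p.1 p.2))) =
          coboundary fun g => Additive.ofMul (Abelianization.of (S.sec g)) := by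
        funext ⟨g, h⟩
        rw [coboundary, eq_sub_iff_add_eq]
        change Additive.ofMul (Abelianization.of (S.inl (S.factorSet g h)) *
          Abelianization.of (S.sec (g * h))) = Additive.ofMul (Abelianization.of (S.sec g) *
          Abelianization.of (S.sec h))
        rw [← map_mul, ← map_mul, sec_mul_sec]
      rw [this, evalAt_coboundary, hz, map_zero]
    rw [← Abelianization.ker_of]
    exact h

end GroupExtension

/-! ### Central extensions from cocycles. -/

/-- The set `K × G`, carrying the group structure twisted by a `2`-cocycle. -/
@[ext]
structure TwistedProduct {K G : Type u} (f : G → G → K) where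
  /-- the component in the kernel -/
  left : K
  /-- the component in the quotient -/
  right : G

namespace TwistedProduct

variable {K G : Type u} [CommGroup K] [Group G] {f : G → G → K}

theorem cocycle_one_left (hf : ∀ g h j, f h j * f g (h * j) = f (g * h) j * f g h) (g : G) :
    f 1 g = f 1 1 := by
  have := hf 1 1 g
  rw [one_mul, one_mul] at this
  exact mul_left_cancel this

theorem cocycle_one_right (hf : ∀ g h j, f h j * f g (h * j) = f (g * h) j * f g h) (g : G) :
    f g 1 = f 1 1 := by
  have := hf g 1 1
  rw [one_mul, mul_one] at this
  exact (mul_right_cancel this).symm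

/-- The group structure on `K × G` twisted by a `2`-cocycle. -/
abbrev group (hf : ∀ g h j, f h j * f g (h * j) = f (g * h) j * f g h) :
    Group (TwistedProduct f) :=
  letI : Mul (TwistedProduct f) := ⟨fun x y => ⟨x.1 * y.1 * f x.2 y.2, x.2 * y.2⟩⟩
  -- The cocycle is not assumed normalized, so the unit carries the correction f(1, 1)⁻¹, as does
  -- the inclusion of K below.
  letI : One (TwistedProduct f) := ⟨⟨(f 1 1)⁻¹, 1⟩⟩
  letI : Inv (TwistedProduct f) := ⟨fun x => ⟨(x.1 * f x.2⁻¹ x.2 * f 1 1)⁻¹, x.2⁻¹⟩⟩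
  Group.ofLeftAxioms
    (fun x y z => by
      ext
      · change x.1 * y.1 * f x.2 y.2 * z.1 * f (x.2 * y.2) z.2 =
          x.1 * (y.1 * z.1 * f y.2 z.2) * f x.2 (y.2 * z.2)
        calc _ = x.1 * y.1 * z.1 * (f (x.2 * y.2) z.2 * f x.2 y.2) := by
              simp only [mul_comm, mul_left_comm, mul_assoc]
          _ = _ := by rw [← hf]; simp only [mul_assoc]
      · exact mul_assoc _ _ _)
    (fun x => by
      ext
      · change (f 1 1)⁻¹ * x.1 * f 1 x.2 = x.1
        rw [cocycle_one_left hf x.2, mul_right_comm, inv_mul_cancel, one_mul]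
      · exact one_mul _)
    (fun x => by
      ext
      · change (x.1 * f x.2⁻¹ x.2 * f 1 1)⁻¹ * x.1 * f x.2⁻¹ x.2 = (f 1 1)⁻¹
        rw [mul_assoc, mul_inv, mul_comm, mul_inv_cancel_left]
      · exact inv_mul_cancel _)

end TwistedProduct

namespace GroupExtension

variable {K G : Type u} [CommGroup K] [Group G]

/-- Every homomorphism out of `H₂(G)` is the differential of a central extension. -/
theorem exists_differential_eq [Finite G] (φ : IntHomology G 2 →+ Additive K) :
    ∃ (X : Type u) (_ : Group X) (S : GroupExtension K X G) (hS : S.IsCentral),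
      S.differential hS = φ := by
  obtain ⟨F, hF, hφ⟩ := exists_cocycle_of_hom φ
  let f : G → G → K := fun g h => (F (g, h)).toMul
  have hf : ∀ g h j, f h j * f g (h * j) = f (g * h) j * f g h := fun g h j => by
    have h1 : F (h, j) + F (g, h * j) = F (g * h, j) + F (g, h) := by
      rw [← sub_eq_zero, ← hF g h j]; abel
    exact congrArg Additive.toMul h1
  let := TwistedProduct.group hf
  have hmul : ∀ x y : TwistedProduct f, x * y = ⟨x.1 * y.1 * f x.2 y.2, x.2 * y.2⟩ :=
    fun _ _ => rfl
  have hone : (1 : TwistedProduct f) = ⟨(f 1 1)⁻¹, 1⟩ := rfl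
  let S : GroupExtension K (TwistedProduct f) G :=
    { inl := MonoidHom.mk' (fun k => ⟨k * (f 1 1)⁻¹, 1⟩) fun k l => by
        rw [hmul]
        ext
        · change k * l * (f 1 1)⁻¹ = k * (f 1 1)⁻¹ * (l * (f 1 1)⁻¹) * f 1 1
          rw [mul_assoc (k * (f 1 1)⁻¹), inv_mul_cancel_right, mul_right_comm]
        · exact (one_mul 1).symm
      rightHom := MonoidHom.mk' (fun x => x.2) fun x y => rfl
      inl_injective := fun k l h => mul_right_cancel (congrArg TwistedProduct.left h)
      range_inl_eq_ker_rightHom := by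
        ext x
        constructor
        · rintro ⟨k, rfl⟩
          rfl
        · intro hx
          refine ⟨x.1 * f 1 1, TwistedProduct.ext ?_ (Eq.symm hx)⟩
          exact mul_inv_cancel_right _ _
      rightHom_surjective := fun g => ⟨⟨1, g⟩, rfl⟩ }
  have hinl : ∀ k, S.inl k = ⟨k * (f 1 1)⁻¹, 1⟩ := fun _ => rfl
  have hS : S.IsCentral := by
    rintro _ ⟨k, rfl⟩
    rw [Subgroup.mem_center_iff]
    intro x
    rw [hinl, hmul, hmul]
    ext
    · simp only [TwistedProduct.cocycle_one_left hf, TwistedProduct.cocycle_one_right hf, mul_comm,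
        mul_left_comm]
    · simp
  refine ⟨_, _, S, hS, evalAt_ext_on_cycles fun z hz => ?_⟩
  rw [← hφ z hz]
  -- The section g ↦ (1, g) has factor set exactly f.
  refine differential_eq_of_section hS (fun g => ⟨1, g⟩) (fun g => rfl) (fun p => f p.1 p.2)
    (fun g h => ?_) z hz
  rw [hinl, hmul, hmul]
  ext
  · simp [TwistedProduct.cocycle_one_left hf]
  · simp

end GroupExtension

/-! ### Abelian groups of bounded exponent, one prime at a time. -/

section BoundedExponent

variable {A B : Type*} [AddCommGroup A] [AddCommGroup B]

theorem eq_zero_of_nsmul_eq_zero_of_prime (h : ∀ p : ℕ, p.Prime → ∀ a : A, p • a = 0 → a = 0)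
    {N : ℕ} (hN : N ≠ 0) (a : A) (ha : N • a = 0) : a = 0 := by
  induction N using Nat.recOnMul generalizing a with
  | zero => exact absurd rfl hN
  | one => simpa using ha
  | prime p hp => exact h p hp a ha
  | mul m n hm hn =>
    rw [mul_smul] at ha
    exact hn (right_ne_zero_of_mul hN) a (hm (left_ne_zero_of_mul hN) _ ha)

/-- Write N = pᵏm with p ∤ m. Without p-torsion m already kills A, and Bézout inverts p modulo m. -/
theorem nsmul_surjective_of_injective {N p : ℕ} (hN : N ≠ 0) (hp : p.Prime)
    (hA : ∀ a : A, N • a = 0) (h : ∀ a : A, p • a = 0 → a = 0) :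
    Function.Surjective fun a : A => p • a := by
  obtain ⟨k, m, hm, rfl⟩ := Nat.exists_eq_pow_mul_and_not_dvd hN p hp.ne_one
  intro a
  have h1 : ∀ j : ℕ, ∀ b : A, p ^ j • b = 0 → b = 0 := fun j => by
    induction j with
    | zero => intro b hb; simpa using hb
    | succ j ih => intro b hb; rw [pow_succ, mul_smul] at hb; exact h _ (ih _ hb)
  have h2 : m • a = 0 := h1 k _ (by rw [← mul_smul]; exact hA a)
  obtain ⟨u, v, huv⟩ := Nat.isCoprime_iff_coprime.2 ((Nat.Prime.coprime_iff_not_dvd hp).2 hm)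
  refine ⟨u • a, ?_⟩
  have h3 : (u * p + v * m : ℤ) • a = a := by rw [huv, one_zsmul]
  rw [add_smul, mul_smul v, natCast_zsmul, h2, smul_zero, add_zero, mul_comm, mul_smul,
    natCast_zsmul] at h3
  exact h3

/-- Write N = pᵏm with p ∤ m. Since every a is a pᵏ-th multiple, m kills A; an element killed by
both p and m is zero. -/
theorem nsmul_injective_of_surjective {N p : ℕ} (hN : N ≠ 0) (hp : p.Prime)
    (hA : ∀ a : A, N • a = 0) (h : Function.Surjective fun a : A => p • a) (a : A)
    (ha : p • a = 0) : a = 0 := by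
  obtain ⟨k, m, hm, rfl⟩ := Nat.exists_eq_pow_mul_and_not_dvd hN p hp.ne_one
  have h1 : ∀ j : ℕ, ∀ b : A, ∃ c, p ^ j • c = b := fun j => by
    induction j with
    | zero => exact fun b => ⟨b, by simp⟩
    | succ j ih =>
      intro b
      obtain ⟨c, rfl⟩ := h b
      obtain ⟨d, rfl⟩ := ih c
      exact ⟨d, by simp only [pow_succ', mul_smul]⟩
  have h2 : m • a = 0 := by
    obtain ⟨c, rfl⟩ := h1 k a
    rw [← mul_smul, mul_comm]
    exact hA c
  obtain ⟨u, v, huv⟩ := Nat.isCoprime_iff_coprime.2 ((Nat.Prime.coprime_iff_not_dvd hp).2 hm)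
  have h3 : (u * p + v * m : ℤ) • a = a := by rw [huv, one_zsmul]
  rw [← h3, add_smul, mul_smul, mul_smul, natCast_zsmul, natCast_zsmul, ha, h2]
  simp

theorem exists_linearMap_apply_eq_one {F V : Type*} [Field F] [AddCommGroup V] [Module F V] {v : V}
    (hv : v ≠ 0) : ∃ f : V →ₗ[F] F, f v = 1 := by
  obtain ⟨f, hf⟩ : ∃ f : Module.Dual F V, f v ≠ 0 := by
    by_contra! hf
    exact hv ((Module.forall_dual_apply_eq_zero_iff F v).1 hf)
  exact ⟨(f v)⁻¹ • f, inv_mul_cancel₀ hf⟩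

theorem exists_hom_zmod_eq_one {p : ℕ} [Fact p.Prime] (hA : ∀ a : A, p • a = 0) {a : A}
    (ha : a ≠ 0) : ∃ f : A →+ ZMod p, f a = 1 := by
  let _ : Module (ZMod p) A := AddCommGroup.zmodModule hA
  obtain ⟨f, hf⟩ := exists_linearMap_apply_eq_one (F := ZMod p) ha
  exact ⟨f.toAddMonoidHom, hf⟩

/-- If `Hom(A, B) = 0`, then `A` is `p`-divisible or `B` has no `p`-torsion. -/
theorem nsmul_surjective_or_injective_of_hom_eq_zero (h : ∀ φ : A →+ B, φ = 0) {p : ℕ}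
    (hp : p.Prime) :
    (Function.Surjective fun a : A => p • a) ∨ ∀ b : B, p • b = 0 → b = 0 := by
  by_contra! H
  obtain ⟨hA, b, hb, hb0⟩ := H
  obtain ⟨a, ha⟩ : ∃ a : A, ∀ c : A, p • c ≠ a := by simpa [Function.Surjective] using hA
  have : Fact p.Prime := ⟨hp⟩
  -- If a ∉ pA and b ≠ 0 is p-torsion, the composite A → A/pA → 𝔽_p → B taking a to b is nonzero.
  let V := A ⧸ (nsmulAddMonoidHom (α := A) p).range
  have hV : ∀ v : V, p • v = 0 := by
    intro v
    obtain ⟨c, rfl⟩ := QuotientAddGroup.mk_surjective v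
    exact (QuotientAddGroup.eq_zero_iff _).2 ⟨c, rfl⟩
  have hv : (QuotientAddGroup.mk a : V) ≠ 0 := by
    rw [Ne, QuotientAddGroup.eq_zero_iff]
    rintro ⟨c, hc⟩
    exact ha c hc
  obtain ⟨f, hf⟩ := exists_hom_zmod_eq_one hV hv
  let g : ZMod p →+ B := ZMod.lift p ⟨zmultiplesHom B b, by simpa using hb⟩
  have hg : g 1 = b := by
    have := ZMod.lift_coe p ⟨zmultiplesHom B b, by simpa using hb⟩ 1
    simpa [g] using this
  have h0 : g (f (QuotientAddGroup.mk a)) = 0 :=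
    DFunLike.congr_fun (h ((g.comp f).comp (QuotientAddGroup.mk' _))) a
  rw [hf, hg] at h0
  exact hb0 h0

end BoundedExponent

/-! ### Localization away from the primes dividing the order of H₁. -/

section H1Local

/-- The primes dividing the order of `H₁(G)` act invertibly on `A`. -/
def IsH1Local (G : Type u) [Group G] (A : Type*) [AddCommGroup A] : Prop :=
  ∀ s ∈ h1PrimeSubmonoid G, Function.Bijective fun a : A => s • a

variable {G : Type u} [Group G] {A : Type*} [AddCommGroup A]

theorem isH1Local_of_prime
    (h : ∀ p : ℕ, p.Prime → p ∣ Nat.card (IntHomology G 1) →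
      Function.Bijective fun a : A => p • a) : IsH1Local G A := by
  intro s hs
  induction hs using Submonoid.closure_induction with
  | mem s hs =>
    obtain ⟨p, hp, hd, rfl⟩ := hs
    simpa only [natCast_zsmul] using h p hp hd
  | one => simpa only [one_zsmul] using! Function.bijective_id
  | mul s t _ _ hs ht => simpa only [mul_smul] using! hs.comp ht

theorem isH1Local_of_injective {N : ℕ} (hN : N ≠ 0) (hA : ∀ a : A, N • a = 0)
    (h : ∀ p : ℕ, p.Prime → p ∣ Nat.card (IntHomology G 1) → ∀ a : A, p • a = 0 → a = 0) :
    IsH1Local G A :=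
  isH1Local_of_prime fun p hp hd =>
    ⟨(injective_iff_map_eq_zero (nsmulAddMonoidHom (α := A) p)).2 (h p hp hd),
      nsmul_surjective_of_injective hN hp hA (h p hp hd)⟩

theorem prime_mem_h1PrimeSubmonoid {p : ℕ} (hp : p.Prime)
    (hd : p ∣ Nat.card (IntHomology G 1)) : (p : ℤ) ∈ h1PrimeSubmonoid G :=
  Submonoid.subset_closure ⟨p, hp, hd, rfl⟩

/-- A quotient of bounded exponent of a local group is local. -/
theorem IsH1Local.of_surjective {B : Type*} [AddCommGroup B] (hA : IsH1Local G A) {N : ℕ}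
    (hN : N ≠ 0) (hB : ∀ b : B, N • b = 0) (f : A →+ B) (hf : Function.Surjective f) :
    IsH1Local G B := by
  -- Divisibility passes to quotients, and bounded exponent converts it back to absence of torsion.
  refine isH1Local_of_injective hN hB fun p hp hd => nsmul_injective_of_surjective hN hp hB ?_
  intro b
  obtain ⟨a, rfl⟩ := hf b
  obtain ⟨c, rfl⟩ := (hA p (prime_mem_h1PrimeSubmonoid hp hd)).2 a
  exact ⟨f c, by simp only [natCast_zsmul, map_nsmul]⟩

/-- `H₁(G)` is the abelianization of `G`. -/
noncomputable def h1EquivAbelianization (G : Type u) [Group G] :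
    IntHomology G 1 ≃+ Additive (Abelianization G) :=
  (groupHomology.H1AddEquivOfIsTrivial (Rep.trivial (ULift.{u} ℤ) G (ULift.{u} ℤ))).trans <|
    (TensorProduct.congr (LinearEquiv.refl ℤ _)
      (AddEquiv.ulift (α := ℤ)).toIntLinearEquiv).toAddEquiv.trans
      (TensorProduct.rid ℤ _).toAddEquiv

theorem card_H1 (G : Type u) [Group G] :
    Nat.card (IntHomology G 1) = Nat.card (Abelianization G) :=
  Nat.card_congr (h1EquivAbelianization G).toEquiv

theorem card_H1_ne_zero [Finite G] : Nat.card (IntHomology G 1) ≠ 0 := by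
  rw [card_H1]
  have : Finite (Abelianization G) := Quotient.finite _
  exact Nat.card_pos.ne'

theorem card_H1_mem_h1PrimeSubmonoid [Finite G] :
    (Nat.card (IntHomology G 1) : ℤ) ∈ h1PrimeSubmonoid G := by
  suffices H : ∀ m : ℕ, m ∣ Nat.card (IntHomology G 1) → (m : ℤ) ∈ h1PrimeSubmonoid G from
    H _ dvd_rfl
  intro m
  induction m using Nat.recOnMul with
  | zero => exact fun h => absurd (zero_dvd_iff.1 h) card_H1_ne_zero
  | one => exact fun _ => by simp
  | prime p hp => exact prime_mem_h1PrimeSubmonoid hp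
  | mul m n hm hn =>
    intro h
    rw [Nat.cast_mul]
    exact Submonoid.mul_mem _ (hm (dvd_of_mul_right_dvd h)) (hn (dvd_of_mul_left_dvd h))

theorem IsH1Local.card_bijective [Finite G] (hA : IsH1Local G A) :
    Function.Bijective fun a : A => Nat.card (IntHomology G 1) • a := by
  simpa only [natCast_zsmul] using hA _ card_H1_mem_h1PrimeSubmonoid

section Localization

variable {B C : Type*} [AddCommGroup B] [AddCommGroup C]

/-- `f : A → B` is a localization away from the primes dividing the order of `H₁(G)`, up to
torsion in the kernel. -/
structure IsH1Localization (G : Type u) [Group G] (f : A →+ B) : Prop where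
  /-- the target is local -/
  isH1Local : IsH1Local G B
  /-- every element of the target is a fraction -/
  exists_zsmul_eq : ∀ b : B, ∃ s ∈ h1PrimeSubmonoid G, ∃ a, s • b = f a

theorem isH1Localization_of_isLocalizedModule {m : Module ℤ A} {m' : Module ℤ B}
    (f : A →ₗ[ℤ] B) [IsLocalizedModule (h1PrimeSubmonoid G) f] :
    IsH1Localization G f.toAddMonoidHom := by
  obtain rfl : m = AddCommGroup.toIntModule A := Subsingleton.elim _ _
  obtain rfl : m' = AddCommGroup.toIntModule B := Subsingleton.elim _ _
  refine ⟨fun s hs => (Module.End.isUnit_iff _).1 (IsLocalizedModule.map_units f ⟨s, hs⟩),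
    fun b => ?_⟩
  obtain ⟨⟨y, s⟩, h⟩ := IsLocalizedModule.surj (h1PrimeSubmonoid G) f b
  exact ⟨s, s.2, y, h⟩

theorem IsH1Localization.hom_ext {f : A →+ B} (hf : IsH1Localization G f) (hC : IsH1Local G C)
    {σ τ : B →+ C} (h : σ.comp f = τ.comp f) : σ = τ := by
  ext x
  obtain ⟨s, hs, y, hy⟩ := hf.exists_zsmul_eq x
  apply (hC s hs).1
  simp only
  rw [← map_zsmul, ← map_zsmul, hy]
  exact DFunLike.congr_fun h y

theorem IsH1Localization.nsmul_eq_zero {f : A →+ B} (hf : IsH1Localization G f) {N : ℕ}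
    (hN : ∀ a : A, N • a = 0) (x : B) : N • x = 0 := by
  obtain ⟨s, hs, y, hy⟩ := hf.exists_zsmul_eq x
  apply (hf.isH1Local s hs).1
  simp only
  rw [smul_comm, hy, ← map_nsmul, hN, map_zero, smul_zero]

/-- The cokernel is again local because its exponent is bounded, yet each of its elements is killed
by some s in the multiplicative set, so it is zero. -/
theorem IsH1Localization.surjective {f : A →+ B} (hf : IsH1Localization G f) {N : ℕ} (hN0 : N ≠ 0)
    (hN : ∀ a : A, N • a = 0) : Function.Surjective f := by
  intro x
  have hQ : IsH1Local G (B ⧸ f.range) := by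
    refine hf.isH1Local.of_surjective hN0 ?_ (QuotientAddGroup.mk' _)
      (QuotientAddGroup.mk'_surjective _)
    intro q
    obtain ⟨y, rfl⟩ := QuotientAddGroup.mk'_surjective _ q
    rw [← map_nsmul, hf.nsmul_eq_zero hN, map_zero]
  obtain ⟨s, hs, y, hy⟩ := hf.exists_zsmul_eq x
  refine (QuotientAddGroup.eq_zero_iff x).1 ((hQ s hs).1 ?_)
  simp only
  rw [smul_zero, ← QuotientAddGroup.mk_zsmul, hy, QuotientAddGroup.eq_zero_iff]
  exact ⟨y, rfl⟩

end Localization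

theorem isH1Localization_loc (G : Type u) [Group G] : IsH1Localization G (H2Minus1.loc G) :=
  isH1Localization_of_isLocalizedModule
    (LocalizedModule.mkLinearMap (h1PrimeSubmonoid G) (IntHomology G 2))

theorem isH1Local_H2Minus1 (G : Type u) [Group G] : IsH1Local G (H2Minus1 G) :=
  (isH1Localization_loc G).isH1Local

theorem exists_hom_H2Minus1 (hA : IsH1Local G A) (φ : IntHomology G 2 →+ A) :
    ∃ σ : H2Minus1 G →+ A, σ.comp (H2Minus1.loc G) = φ := by
  have hu : ∀ s : h1PrimeSubmonoid G, IsUnit (algebraMap ℤ (Module.End ℤ A) s) := fun s =>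
    (Module.End.isUnit_iff _).2 (hA s s.2)
  refine ⟨(LocalizedModule.lift (h1PrimeSubmonoid G) φ.toIntLinearMap hu).toAddMonoidHom, ?_⟩
  ext y
  exact LinearMap.congr_fun (LocalizedModule.lift_comp (h1PrimeSubmonoid G) φ.toIntLinearMap hu) y

theorem card_nsmul_H2Minus1 [Finite G] (x : H2Minus1 G) : Nat.card G • x = 0 :=
  (isH1Localization_loc G).nsmul_eq_zero card_nsmul_H2 x

theorem loc_surjective [Finite G] : Function.Surjective (H2Minus1.loc G) :=
  (isH1Localization_loc G).surjective Nat.card_pos.ne' card_nsmul_H2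

end H1Local

theorem Abelianization.of_surjective {G : Type*} [Group G] :
    Function.Surjective (Abelianization.of : G →* Abelianization G) :=
  QuotientGroup.mk'_surjective (commutator G)

/-! ### Surjective generalized subgroups: vanishing of Hom(X, K) and its consequences. -/

section Generalized

variable {K X G : Type u} [CommGroup K] [Group X] [Group G] {S : GroupExtension K X G}

/-- Two endomorphisms of X with the same projection differ by a map to K, which is multiplicative
because K is central. -/
theorem GroupExtension.IsCentral.isGeneralizedSubgroup (hS : S.IsCentral)
    (h : ∀ φ : X →* K, φ = 1) : IsGeneralizedSubgroup S.rightHom := by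
  intro f g hfg
  choose k hk using fun x => S.exists_inl_mul_eq (DFunLike.congr_fun hfg x)
  have hφ := h (MonoidHom.mk' k fun x y => by
    apply S.inl_injective
    apply mul_right_cancel (b := g (x * y))
    rw [← hk, map_mul f, hk x, hk y, map_mul g, map_mul S.inl]
    calc _ = S.inl (k x) * (g x * S.inl (k y)) * g y := by group
      _ = _ := by rw [hS.comm]; group)
  ext x
  have hx : k x = 1 := DFunLike.congr_fun hφ x
  rw [hk x, hx, map_one, one_mul]

/-- Such a φ kills K, so it factors through G and then Gᵃᵇ; its values are killed by |H₁|, which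
acts injectively on K. -/
theorem hom_eq_one_of_le_commutator [Finite G] (hK : IsH1Local G (Additive K))
    (hc : ∀ k, S.inl k ∈ commutator X) (φ : X →* K) : φ = 1 := by
  have hker : S.rightHom.ker ≤ φ.ker := by
    rw [← S.range_inl_eq_ker_rightHom]
    rintro _ ⟨k, rfl⟩
    exact Abelianization.commutator_subset_ker φ (hc k)
  let ψ : G →* K := S.rightHom.liftOfSurjective S.rightHom_surjective ⟨φ, hker⟩
  have hψ : ∀ x, ψ (S.rightHom x) = φ x := fun x =>
    MonoidHom.liftOfRightInverse_comp_apply _ _ _ ⟨φ, hker⟩ x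
  ext x
  have hn : Nat.card (IntHomology G 1) • Additive.ofMul (φ x) = 0 := by
    rw [card_H1, ← hψ, ← Abelianization.lift_apply_of ψ]
    change Additive.ofMul (Abelianization.lift ψ (Abelianization.of (S.rightHom x)) ^ _) = 0
    rw [← map_pow, pow_card_eq_one', map_one]
    rfl
  exact hK.card_bijective.1 (hn.trans (smul_zero _).symm)

end Generalized

namespace SurjGenSubgroup

variable {G : Type u} [Group G] (a : SurjGenSubgroup G)

/-- The map x ↦ xφ(x) is an endomorphism with the same projection as the identity. -/
theorem hom_to_ker_eq_one (φ : a.X →* a.hom.ker) : φ = 1 := by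
  have hc : ∀ x y, y * (φ x : a.X) = φ x * y := fun x y =>
    Subgroup.mem_center_iff.1 (a.ker_le_center (φ x).2) y
  have h : (MonoidHom.mk' (fun x => x * (φ x : a.X)) fun x y => by
      rw [map_mul, Subgroup.coe_mul]
      calc x * y * (φ x * φ y) = x * (y * φ x) * φ y := by group
        _ = _ := by rw [hc x y]; group) = MonoidHom.id a.X := by
    apply a.isGen
    ext x
    simp [MonoidHom.mem_ker.1 (φ x).2]
  ext x
  have := DFunLike.congr_fun h x
  simpa using this

/-- The transfer to a central subgroup of index n is x ↦ xⁿ. Here it lands in the kernel, where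
every homomorphism from X is trivial. -/
theorem pow_card_eq_one_of_finite [Finite G] (x : a.X) : x ^ Nat.card G = 1 := by
  have hi : a.hom.ker.index = Nat.card G := by
    rw [Subgroup.index_ker, MonoidHom.range_eq_top.2 a.surjective, Subgroup.card_top]
  have : a.hom.ker.FiniteIndex := ⟨by rw [hi]; exact Nat.card_pos.ne'⟩
  have key : ∀ (k : ℕ) (g₀ : a.X), g₀⁻¹ * x ^ k * g₀ ∈ a.hom.ker → g₀⁻¹ * x ^ k * g₀ = x ^ k := by
    intro k g₀ hk
    have := Subgroup.mem_center_iff.1 (a.ker_le_center hk) g₀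
    calc g₀⁻¹ * x ^ k * g₀ = g₀ * (g₀⁻¹ * x ^ k * g₀) * g₀⁻¹ := by rw [this]; group
      _ = _ := by group
  have h := MonoidHom.transfer_eq_pow (MonoidHom.id a.hom.ker) x key
  rw [a.hom_to_ker_eq_one (MonoidHom.transfer (MonoidHom.id a.hom.ker))] at h
  have := congrArg Subtype.val h
  rw [← hi]
  exact this.symm

theorem card_nsmul_ker [Finite G] (k : Additive a.hom.ker) : Nat.card G • k = 0 :=
  congrArg Additive.ofMul (Subtype.ext (a.pow_card_eq_one_of_finite k.toMul.1) :
    k.toMul ^ Nat.card G = 1)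

theorem card_nsmul_abelianization [Finite G] (x : Additive (Abelianization a.X)) :
    Nat.card G • x = 0 := by
  obtain ⟨y, hy⟩ := Abelianization.of_surjective x.toMul
  have : Abelianization.of y ^ Nat.card G = 1 := by
    rw [← map_pow, pow_card_eq_one_of_finite, map_one]
  rw [hy] at this
  exact congrArg Additive.ofMul this

theorem addHom_abelianization_eq_zero
    (φ : Additive (Abelianization a.X) →+ Additive a.hom.ker) : φ = 0 := by
  refine AddMonoidHom.ext fun x => ?_
  obtain ⟨y, hy⟩ := Abelianization.of_surjective x.toMul
  have h := DFunLike.congr_fun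
    (a.hom_to_ker_eq_one ((AddMonoidHom.toMultiplicative φ).comp Abelianization.of)) y
  have h' : φ (Additive.ofMul (Abelianization.of y)) = 0 := congrArg Additive.ofMul h
  rwa [hy] at h'

/-- For each p, the image of K in Xᵃᵇ has no p-torsion: either Xᵃᵇ is p-divisible and so
p-torsion-free, or K is p-torsion-free, so p-divisible, and so is its image. A group of bounded
exponent without torsion at any prime is zero. -/
theorem ker_le_commutator [Finite G] : a.hom.ker ≤ commutator a.X := by
  intro k hk
  have hN : Nat.card G ≠ 0 := Nat.card_pos.ne'
  let f : Additive a.hom.ker →+ Additive (Abelianization a.X) :=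
    MonoidHom.toAdditive (Abelianization.of.comp a.hom.ker.subtype)
  have hf : ∀ q : f.range, Nat.card G • q = 0 := fun q =>
    Subtype.ext (a.card_nsmul_abelianization q.1)
  have h : ∀ p : ℕ, p.Prime → ∀ q : f.range, p • q = 0 → q = 0 := by
    intro p hp
    rcases nsmul_surjective_or_injective_of_hom_eq_zero a.addHom_abelianization_eq_zero hp with
      hA | hK
    · exact fun q hq => Subtype.ext (nsmul_injective_of_surjective hN hp
        a.card_nsmul_abelianization hA q.1 (congrArg Subtype.val hq))
    · refine nsmul_injective_of_surjective hN hp hf ?_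
      rintro ⟨_, k, rfl⟩
      obtain ⟨l, rfl⟩ := nsmul_surjective_of_injective hN hp a.card_nsmul_ker hK k
      exact ⟨⟨f l, l, rfl⟩, Subtype.ext (map_nsmul f p l).symm⟩
  have h0 := eq_zero_of_nsmul_eq_zero_of_prime h hN
    (⟨f (Additive.ofMul ⟨k, hk⟩), _, rfl⟩ : f.range) (hf _)
  rw [← Abelianization.ker_of]
  exact congrArg Subtype.val h0

/-- If p divides |H₁(G)|, then Xᵃᵇ is not p-divisible, since its quotient Gᵃᵇ is finite with an
element of order p. Hence K has no p-torsion. -/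
theorem isH1Local_ker [Finite G] : IsH1Local G (Additive a.hom.ker) := by
  have hN : Nat.card G ≠ 0 := Nat.card_pos.ne'
  refine isH1Local_of_injective hN a.card_nsmul_ker fun p hp hd => ?_
  refine (nsmul_surjective_or_injective_of_hom_eq_zero a.addHom_abelianization_eq_zero
    hp).resolve_left fun hs => ?_
  have : Finite (Abelianization G) := Quotient.finite _
  have hsurj : Function.Surjective fun x : Abelianization G => x ^ p := by
    intro x
    obtain ⟨g, rfl⟩ := Abelianization.of_surjective x
    obtain ⟨y, rfl⟩ := a.surjective g
    obtain ⟨z, hz⟩ := hs (Additive.ofMul (Abelianization.of y))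
    refine ⟨Abelianization.map a.hom z.toMul, ?_⟩
    have hz' : z.toMul ^ p = Abelianization.of y := congrArg Additive.toMul hz
    simp only
    rw [← map_pow, hz', Abelianization.map_of]
  have hinj := Finite.injective_iff_surjective.2 hsurj
  rw [card_H1] at hd
  have : Fact p.Prime := ⟨hp⟩
  obtain ⟨x, hx⟩ := exists_prime_orderOf_dvd_card' p hd
  have hx1 : x = 1 := hinj (by simp only [one_pow]; rw [← hx, pow_orderOf_eq_one])
  rw [hx1, orderOf_one] at hx
  exact hp.one_lt.ne hx

theorem differential_surjective [Finite G] : Function.Surjective a.differential := fun k =>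
  (GroupExtension.inl_mem_commutator_iff a.extension_isCentral k.toMul).1
    (a.ker_le_commutator k.toMul.2)

variable {a}

theorem IsLocalizedDifferential.surjective [Finite G] {σ : H2Minus1 G →+ Additive a.hom.ker}
    (hσ : a.IsLocalizedDifferential σ) : Function.Surjective σ := fun k => by
  obtain ⟨x, rfl⟩ := a.differential_surjective k
  exact ⟨H2Minus1.loc G x, DFunLike.congr_fun hσ x⟩

theorem IsLocalizedDifferential.unique [Finite G] {σ τ : H2Minus1 G →+ Additive a.hom.ker}
    (hσ : a.IsLocalizedDifferential σ) (hτ : a.IsLocalizedDifferential τ) : τ = σ :=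
  (isH1Localization_loc G).hom_ext a.isH1Local_ker (hτ.trans hσ.symm)

variable (a) in
theorem exists_isLocalizedDifferential [Finite G] : ∃ σ, a.IsLocalizedDifferential σ :=
  exists_hom_H2Minus1 a.isH1Local_ker a.differential

/-- A morphism of surjective generalized subgroups restricts to the kernels. -/
def kerMap {b : SurjGenSubgroup G} (π : a.X →* b.X) (hπ : b.hom.comp π = a.hom) :
    a.hom.ker →* b.hom.ker :=
  (π.comp a.hom.ker.subtype).codRestrict _ fun k => by
    have := DFunLike.congr_fun hπ k.1
    exact this.trans k.2

theorem IsLocalizedDifferential.comp_of_hom {b : SurjGenSubgroup G}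
    {σ : H2Minus1 G →+ Additive a.hom.ker} (hσ : a.IsLocalizedDifferential σ)
    (π : a.X →* b.X) (hπ : b.hom.comp π = a.hom) :
    b.IsLocalizedDifferential ((MonoidHom.toAdditive (kerMap π hπ)).comp σ) := by
  ext x
  have h := GroupExtension.differential_natural a.extension_isCentral b.extension_isCentral π
    (kerMap π hπ) (fun _ => rfl) (DFunLike.congr_fun hπ) x
  have h' := DFunLike.congr_fun hσ x
  refine congrArg (fun z : Additive b.hom.ker => (z.toMul : b.X)) (Eq.trans ?_ h.symm)
  exact congrArg (MonoidHom.toAdditive (kerMap π hπ)) h'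

/-- Surjective generalized subgroups with equivalent localized differentials are equivalent. -/
theorem equiv_of_localizedDifferential [Finite G] {b : SurjGenSubgroup G}
    {σ : H2Minus1 G →+ Additive a.hom.ker} (hσ : a.IsLocalizedDifferential σ)
    {τ : H2Minus1 G →+ Additive b.hom.ker} (hτ : b.IsLocalizedDifferential τ)
    (h : Additive a.hom.ker ≃+ Additive b.hom.ker) (hh : h.toAddMonoidHom.comp σ = τ) :
    ∃ e : a.X ≃* b.X, b.hom.comp e.toMonoidHom = a.hom := by
  -- The kernel of b is local, so the isomorphism of kernels lifts to X; the five lemma makes the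
  -- lift an isomorphism.
  obtain ⟨π, h1, h2⟩ := GroupExtension.exists_hom_of_differential a.extension_isCentral
    b.extension_isCentral b.isH1Local_ker.card_bijective
    (AddMonoidHom.toMultiplicative h.toAddMonoidHom : a.hom.ker →* b.hom.ker) fun x => by
      have e1 : τ (H2Minus1.loc G x) = b.differential x := DFunLike.congr_fun hτ x
      have e2 : σ (H2Minus1.loc G x) = a.differential x := DFunLike.congr_fun hσ x
      have e3 : h (σ (H2Minus1.loc G x)) = τ (H2Minus1.loc G x) := DFunLike.congr_fun hh _
      change b.differential x = h (a.differential x)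
      rw [← e1, ← e2, e3]
  exact ⟨MulEquiv.ofBijective π (GroupExtension.bijective_of_morphism π _ h1 h2 h.bijective),
    MonoidHom.ext h2⟩

/-- The surjective generalized subgroup given by the projection of an extension. -/
def ofExtension {K X : Type u} [Group K] [Group X] (S : GroupExtension K X G)
    (h : IsGeneralizedSubgroup S.rightHom) : SurjGenSubgroup G where
  X := X
  hom := S.rightHom
  surjective := S.rightHom_surjective
  isGen := h

/-- Every surjection out of `H_{2∖1}(G)` is the localized differential of a surjective generalized
subgroup. -/
theorem exists_of_surjection [Finite G] {L : Type u} [AddCommGroup L] (τ : H2Minus1 G →+ L)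
    (hτ : Function.Surjective τ) :
    ∃ (a : SurjGenSubgroup G) (h : L ≃+ Additive a.hom.ker),
      a.IsLocalizedDifferential (h.toAddMonoidHom.comp τ) := by
  have hL : IsH1Local G L := (isH1Local_H2Minus1 G).of_surjective Nat.card_pos.ne' (fun l => by
    obtain ⟨x, rfl⟩ := hτ l
    rw [← map_nsmul, card_nsmul_H2Minus1, map_zero]) τ hτ
  obtain ⟨X, _, S, hS, hφ⟩ := GroupExtension.exists_differential_eq (K := Multiplicative L)
    (τ.comp (H2Minus1.loc G))
  -- The differential is the composite of two surjections, so the whole kernel consists of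
  -- commutators.
  have hc : ∀ k, S.inl k ∈ commutator X := fun k => by
    rw [GroupExtension.inl_mem_commutator_iff hS, hφ]
    obtain ⟨x, hx⟩ := (hτ.comp loc_surjective) k.toAdd
    exact ⟨x, hx⟩
  have hgen := hS.isGeneralizedSubgroup (hom_eq_one_of_le_commutator hL hc)
  let κ : Multiplicative L →* (ofExtension S hgen).hom.ker := S.inl.codRestrict _ fun k => S.rightHom_inl k
  have hκ : Function.Bijective κ := by
    refine ⟨fun k l h => S.inl_injective (congrArg Subtype.val h), fun y => ?_⟩
    have hy : y.1 ∈ S.inl.range := by rw [S.range_inl_eq_ker_rightHom]; exact y.2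
    obtain ⟨k, hk⟩ := hy
    exact ⟨k, Subtype.ext hk⟩
  refine ⟨ofExtension S hgen, MulEquiv.toAdditiveRight (MulEquiv.ofBijective κ hκ), ?_⟩
  refine AddMonoidHom.ext fun x => ?_
  -- The kernel of the projection is L only up to κ; naturality along the identity of X transfers
  -- the differential.
  have h := GroupExtension.differential_natural hS (ofExtension S hgen).extension_isCentral (MonoidHom.id X) κ
    (fun _ => rfl) (fun _ => rfl) x
  rw [hφ] at h
  exact h.symm

end SurjGenSubgroup

/-! ### Push-out squares and the initial extension. -/

/-- A commutative square of groups with surjective horizontal map `f : A → B`, whose opposite side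
`g : C → D` is surjective with kernel the image of the kernel of `f`, is a push-out square. -/
theorem isPushout_of_ker_le {A B C D : Type u} [Group A] [Group B] [Group C] [Group D]
    (i : A →* C) (f : A →* B) (g : C →* D) (j : B →* D) (hw : g.comp i = j.comp f)
    (hf : Function.Surjective f) (hg : Function.Surjective g) (hk : g.ker ≤ f.ker.map i) :
    CategoryTheory.IsPushout (GrpCat.ofHom i) (GrpCat.ofHom f) (GrpCat.ofHom g)
      (GrpCat.ofHom j) := by
  refine ⟨⟨?_⟩, ⟨CategoryTheory.Limits.PushoutCocone.IsColimit.mk _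
    (fun s => GrpCat.ofHom (g.liftOfSurjective hg ⟨s.inl.hom, ?_⟩)) ?_ ?_ ?_⟩⟩
  · rw [← GrpCat.ofHom_comp, ← GrpCat.ofHom_comp, hw]
  -- The leg out of C kills i(ker f) by commutativity of the cocone, hence descends to D.
  · refine hk.trans ?_
    rintro _ ⟨x, hx, rfl⟩
    have := congrArg (fun t => t.hom x) s.condition
    have h' : s.inl.hom (i x) = s.inr.hom (f x) := this
    rw [MonoidHom.mem_ker, h', show f x = 1 from hx, map_one]
  · intro s
    ext x
    exact MonoidHom.liftOfRightInverse_comp_apply g (Function.surjInv hg)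
      (Function.rightInverse_surjInv hg) ⟨s.inl.hom, _⟩ x
  · intro s
    ext b
    obtain ⟨x, rfl⟩ := hf b
    have h1 : s.inl.hom (i x) = s.inr.hom (f x) := congrArg (fun t => t.hom x) s.condition
    have h2 : g (i x) = j (f x) := DFunLike.congr_fun hw x
    change g.liftOfSurjective hg _ (j (f x)) = s.inr.hom (f x)
    rw [← h2, ← h1]
    exact MonoidHom.liftOfRightInverse_comp_apply g (Function.surjInv hg)
      (Function.rightInverse_surjInv hg) ⟨s.inl.hom, _⟩ (i x)
  · intro s m hm _
    ext d
    obtain ⟨x, rfl⟩ := hg d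
    have h1 : m.hom (g x) = s.inl.hom x := congrArg (fun t => t.hom x) hm
    rw [h1]
    exact (MonoidHom.liftOfRightInverse_comp_apply g (Function.surjInv hg)
      (Function.rightInverse_surjInv hg) ⟨s.inl.hom, _⟩ x).symm

theorem GroupExtension.exists_isInitial (I : Type u) [Group I] [Finite I] :
    ∃ (E : Type u) (_ : Group E) (e : GroupExtension (Multiplicative (H2Minus1 I)) E I),
      e.IsInitial := by
  obtain ⟨E, _, e, he, h⟩ :=
    exists_differential_eq (K := Multiplicative (H2Minus1 I)) (H2Minus1.loc I)
  exact ⟨E, _, e, he, fun x => congrArg Additive.toMul (DFunLike.congr_fun h x)⟩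

/-- Both differentials are the localization map and H_{2∖1}(I) is local, so its identity lifts to a
morphism of extensions. -/
theorem GroupExtension.IsInitial.nonempty_equiv {I E E' : Type u} [Group I] [Finite I] [Group E]
    [Group E'] {e : GroupExtension (Multiplicative (H2Minus1 I)) E I}
    {e' : GroupExtension (Multiplicative (H2Minus1 I)) E' I} (h : e.IsInitial)
    (h' : e'.IsInitial) : Nonempty (e.Equiv e') := by
  obtain ⟨he, hx⟩ := h
  obtain ⟨he', hx'⟩ := h'
  have hloc : IsH1Local I (Additive (Multiplicative (H2Minus1 I))) := isH1Local_H2Minus1 I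
  obtain ⟨π, h1, h2⟩ := exists_hom_of_differential he he' hloc.card_bijective
    (MonoidHom.id _) fun x => (hx' x).trans (hx x).symm
  exact ⟨{ MulEquiv.ofBijective π (bijective_of_morphism π _ h1 h2 Function.bijective_id) with
    inl_comm := funext h1
    rightHom_comm := funext h2 }⟩

/-- The map σ carries the differential of e to that of a, so it lifts to π. Since π lies over the
identity of I, it is surjective because σ is, and its kernel is the image of the kernel of σ. -/
theorem GroupExtension.IsInitial.exists_isPushout {I E : Type u} [Group I] [Finite I] [Group E]
    {e : GroupExtension (Multiplicative (H2Minus1 I)) E I} (h : e.IsInitial)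
    {a : SurjGenSubgroup I} {σ : H2Minus1 I →+ Additive a.hom.ker}
    (hσ : a.IsLocalizedDifferential σ) :
    ∃ π : E →* a.X, a.hom.comp π = e.rightHom ∧
      CategoryTheory.IsPushout (GrpCat.ofHom e.inl)
        (GrpCat.ofHom (AddMonoidHom.toMultiplicativeLeft σ))
        (GrpCat.ofHom π) (GrpCat.ofHom a.hom.ker.subtype) := by
  obtain ⟨he, hx⟩ := h
  have hs := hσ.surjective
  obtain ⟨π, h1, h2⟩ := exists_hom_of_differential he a.extension_isCentral
    a.isH1Local_ker.card_bijective (AddMonoidHom.toMultiplicativeLeft σ) fun x => by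
      have e1 : σ (H2Minus1.loc I x) = a.differential x := DFunLike.congr_fun hσ x
      have e2 : e.differential he x = Additive.ofMul (Multiplicative.ofAdd (H2Minus1.loc I x)) :=
        hx x
      rw [e2]
      exact e1.symm
  refine ⟨π, MonoidHom.ext h2, isPushout_of_ker_le _ _ _ _ (MonoidHom.ext h1) hs (fun y => ?_) ?_⟩
  · obtain ⟨x, hx⟩ := e.rightHom_surjective (a.hom y)
    obtain ⟨k', hk'⟩ := a.extension.exists_inl_mul_eq (x := y) (y := π x)
      (by rw [h2, hx]; rfl)
    obtain ⟨k, hk⟩ := hs k'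
    exact ⟨e.inl (Multiplicative.ofAdd k) * x, by rw [hk', map_mul, h1, ← hk]; rfl⟩
  · intro x hx
    have : x ∈ e.rightHom.ker := by
      rw [MonoidHom.mem_ker, ← h2, MonoidHom.mem_ker.1 hx, map_one]
    rw [← e.range_inl_eq_ker_rightHom] at this
    obtain ⟨k, rfl⟩ := this
    refine ⟨k, ?_, rfl⟩
    rw [MonoidHom.mem_ker, h1] at hx
    exact a.extension.inl_injective (hx.trans (map_one _).symm)

/-! ### The bijection between generalized subgroups and quotients. -/

/-- The class of the localized differential of a surjective generalized subgroup. -/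
noncomputable def SurGenSub.differentialClass (I : Type u) [Group I] [Finite I] :
    SurGenSub I → QuotSet (H2Minus1 I) :=
  Quotient.lift (fun a => Quotient.mk (AbSurjection.setoid (H2Minus1 I))
    ⟨Additive a.hom.ker, a.exists_isLocalizedDifferential.choose,
      a.exists_isLocalizedDifferential.choose_spec.surjective⟩) (by
    rintro a b ⟨h, hh⟩
    refine Quotient.sound ⟨AddEquiv.ofBijective
      (MonoidHom.toAdditive (SurjGenSubgroup.kerMap h.toMonoidHom hh)) ⟨?_, ?_⟩, ?_⟩
    · intro k l hkl
      exact Subtype.ext (h.injective (congrArg (fun z : Additive b.hom.ker => (z.toMul : b.X)) hkl))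
    · intro y
      have hy : a.hom (h.symm y.toMul.1) = 1 := by
        rw [← hh]
        simpa using y.toMul.2
      exact ⟨Additive.ofMul ⟨_, hy⟩, Subtype.ext (h.apply_symm_apply _)⟩
    -- Transporting the factorization for a along h gives one for b, and factorizations are unique,
    -- so the choices do not matter.
    · exact b.exists_isLocalizedDifferential.choose_spec.unique
        (a.exists_isLocalizedDifferential.choose_spec.comp_of_hom h.toMonoidHom hh))

theorem SurGenSub.differentialClass_mk {I : Type u} [Group I] [Finite I] (a : SurjGenSubgroup I)
    (σ : H2Minus1 I →+ Additive a.hom.ker) (hσ : Function.Surjective σ)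
    (h : a.IsLocalizedDifferential σ) :
    differentialClass I (Quotient.mk (SurjGenSubgroup.setoid I) a) =
      Quotient.mk (AbSurjection.setoid (H2Minus1 I)) ⟨Additive a.hom.ker, σ, hσ⟩ := by
  obtain rfl := a.exists_isLocalizedDifferential.choose_spec.unique h
  rfl

theorem SurGenSub.differentialClass_bijective (I : Type u) [Group I] [Finite I] :
    Function.Bijective (differentialClass I) := by
  constructor
  · intro x y
    obtain ⟨a, rfl⟩ := Quotient.exists_rep x
    obtain ⟨b, rfl⟩ := Quotient.exists_rep y
    intro h
    obtain ⟨e, he⟩ := Quotient.exact h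
    exact Quotient.sound (SurjGenSubgroup.equiv_of_localizedDifferential
      a.exists_isLocalizedDifferential.choose_spec b.exists_isLocalizedDifferential.choose_spec
      e he)
  · intro q
    obtain ⟨⟨L, τ, hτ⟩, rfl⟩ := Quotient.exists_rep q
    obtain ⟨a, h, ha⟩ := SurjGenSubgroup.exists_of_surjection τ hτ
    refine ⟨Quotient.mk _ a, ?_⟩
    rw [differentialClass_mk a _ ha.surjective ha]
    exact (Quotient.sound (s := AbSurjection.setoid (H2Minus1 I)) ⟨h, rfl⟩).symm

theorem mainTheorem5 (I : Type u) [Group I] [Finite I] :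
    -- the differential of `a : X ↠ I` factors uniquely through `H_{2∖1}(I)`, by a surjection
    (∀ a : SurjGenSubgroup I, ∃ σ : H2Minus1 I →+ Additive a.hom.ker,
      a.IsLocalizedDifferential σ ∧ Function.Surjective σ ∧
      ∀ τ : H2Minus1 I →+ Additive a.hom.ker, a.IsLocalizedDifferential τ → τ = σ) ∧
    -- sending the class of `a` to the class of that surjection is well defined and bijective
    (∃ μ : SurGenSub I → QuotSet (H2Minus1 I),
      (∀ (a : SurjGenSubgroup I) (σ : H2Minus1 I →+ Additive a.hom.ker)
        (hσ : Function.Surjective σ), a.IsLocalizedDifferential σ →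
          μ (Quotient.mk (SurjGenSubgroup.setoid I) a) =
            Quotient.mk (AbSurjection.setoid (H2Minus1 I)) ⟨Additive a.hom.ker, σ, hσ⟩) ∧
      Function.Bijective μ) ∧
    -- the initial extension exists and is unique up to equivalence of extensions
    (∃ (E : Type u) (_ : Group E) (e : GroupExtension (Multiplicative (H2Minus1 I)) E I),
      e.IsInitial) ∧
    (∀ (E E' : Type u) [Group E] [Group E']
      (e : GroupExtension (Multiplicative (H2Minus1 I)) E I)
      (e' : GroupExtension (Multiplicative (H2Minus1 I)) E' I),
      e.IsInitial → e'.IsInitial → Nonempty (e.Equiv e')) ∧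
    -- every `a : X ↠ I` is the push-out of the initial extension along its differential
    (∀ (E : Type u) [Group E] (e : GroupExtension (Multiplicative (H2Minus1 I)) E I),
      e.IsInitial → ∀ (a : SurjGenSubgroup I) (σ : H2Minus1 I →+ Additive a.hom.ker),
        a.IsLocalizedDifferential σ →
          ∃ π : E →* a.X, a.hom.comp π = e.rightHom ∧
            CategoryTheory.IsPushout (GrpCat.ofHom e.inl)
              (GrpCat.ofHom (AddMonoidHom.toMultiplicativeLeft σ))
              (GrpCat.ofHom π) (GrpCat.ofHom a.hom.ker.subtype)) := by
  refine ⟨fun a => ?_, ⟨SurGenSub.differentialClass I, SurGenSub.differentialClass_mk,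
    SurGenSub.differentialClass_bijective I⟩, GroupExtension.exists_isInitial I,
    fun E E' _ _ e e' h h' => h.nonempty_equiv h', fun E _ e h a σ hσ => h.exists_isPushout hσ⟩
  obtain ⟨σ, hσ⟩ := a.exists_isLocalizedDifferential
  exact ⟨σ, hσ, hσ.surjective, fun τ hτ => hσ.unique hτ⟩
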